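/- Let $G$ be a caterpillar graph, i.e. a (finite) tree that contains a path $P$ such that every vertex of $G$ lies on $P$ or is adjacent to a vertex of $P$. Let $K$ be a field and $S=K[x_v : v\in V(G)]$. For $A\subseteq V(G)$ put $\mathbf{x}_A=\prod_{v\in A}x_v$. The closed neighborhood complex $\mathcal N(G)$ is the simplicial complex whose facets are the inclusion-minimal closed neighborhoods $N_G[u]=\{u\}\cup\{v:\{u,v\}\in E(G)\}$, and $NI(G)=(\mathbf{x}_F : F \text{ a facet of } \mathcal N(G))\subseteq S$ is the closed neighborhood ideal of $G$. Let $\nu$ be the matching number of $\mathcal N(G)$, i.e. the maximal number of pairwise disjoint facets. For a monomial ideal $I$ let $I^{[k]}$ be the ideal generated by the squarefree monomials in $I^k$, and let $\deg(I)$ be the largest degree of a minimal monomial generator of $I$. For a homogeneous ideal $I\subseteq S$ let $\beta_{i,j}(S/I)$ be the graded Betti numbers of a minimal graded free resolution of $S/I$, and $\operatorname{reg}(S/I)=\max\{j : \beta_{i,i+j}(S/I)\neq 0 \text{ for some } i\}$. Then $$\operatorname{reg}\bigl(S/NI(G)^{[\nu]}\bigr)=\deg\bigl(NI(G)^{[\nu]}\bigr)-1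 .$$ -/

import Mathlib

noncomputable section

namespace CaterpillarReg

/-! ### Graphs and the closed neighborhood complex -/

/-- A caterpillar: a tree with a path `P` such that every vertex lies on `P` or is adjacent to a
vertex of `P`. -/
def IsCaterpillar {V : Type*} (G : SimpleGraph V) : Prop :=
  G.IsTree ∧ ∃ (a b : V) (P : G.Walk a b), P.IsPath ∧
    ∀ w : V, w ∈ P.support ∨ ∃ x ∈ P.support, G.Adj x w

open Classical in
/-- The closed neighborhood `N_G[u]`. -/
def closedNeighborhood {V : Type*} [Fintype V] (G : SimpleGraph V) (u : V) : Finset V :=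
  Finset.univ.filter fun v => v = u ∨ G.Adj u v

/-- The (set of faces of the) closed neighborhood complex `𝒩(G)`: all subsets of those closed
neighborhoods that contain no other closed neighborhood properly. Its facets are the
inclusion-minimal closed neighborhoods. -/
def neighborhoodComplex {V : Type*} [Fintype V] (G : SimpleGraph V) : Set (Finset V) :=
  {F | ∃ u : V, F ⊆ closedNeighborhood G u ∧
    ∀ v : V, ¬ closedNeighborhood G v ⊂ closedNeighborhood G u}

/-- The facets (maximal faces) of a simplicial complex given by its set of faces. -/
def facets {V : Type*} (Δ : Set (Finset V)) : Set (Finset V) :=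
  {F | Maximal (· ∈ Δ) F}

/-- A matching of `Δ`: a set of pairwise disjoint facets. -/
def IsMatching {V : Type*} (Δ : Set (Finset V)) (M : Finset (Finset V)) : Prop :=
  (∀ F ∈ M, F ∈ facets Δ) ∧ (M : Set (Finset V)).PairwiseDisjoint id

/-- The matching number `ν(Δ)`: the largest number of facets in a matching
(the set below is bounded, as there are finitely many subsets of `V`). -/
def matchingNumber {V : Type*} [Fintype V] (Δ : Set (Finset V)) : ℕ :=
  sSup {k | ∃ M : Finset (Finset V), IsMatching Δ M ∧ M.card = k}

/-! ### Monomial ideals -/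

/-- The squarefree monomial `x_A = ∏_{u ∈ A} x_u`. -/
def sqfreeMonomial {V : Type*} (K : Type*) [Field K] (A : Finset V) : MvPolynomial V K :=
  ∏ u ∈ A, MvPolynomial.X u

/-- The facet ideal `I(Δ) = (x_F : F a facet of Δ)`. -/
def facetIdeal {V : Type*} (K : Type*) [Field K] (Δ : Set (Finset V)) :
    Ideal (MvPolynomial V K) :=
  Ideal.span (sqfreeMonomial K '' facets Δ)

/-- The closed neighborhood ideal `NI(G)`. -/
def closedNeighborhoodIdeal {V : Type*} [Fintype V] (K : Type*) [Field K] (G : SimpleGraph V) :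
    Ideal (MvPolynomial V K) :=
  facetIdeal K (neighborhoodComplex G)

/-- The squarefree power `I^{[k]}`: the ideal generated by the squarefree monomials in `I^k`. -/
def squarefreePower {V : Type*} {K : Type*} [Field K] (I : Ideal (MvPolynomial V K)) (k : ℕ) :
    Ideal (MvPolynomial V K) :=
  Ideal.span {p | p ∈ I ^ k ∧ ∃ A : Finset V, p = sqfreeMonomial K A}

/-- The exponents of the minimal monomial generators `𝒢(I)` of a monomial ideal `I`: the monomials
of `I` that are minimal for divisibility (the pointwise order on exponents). -/
def minimalGenerators {V : Type*} {K : Type*} [Field K] (I : Ideal (MvPolynomial V K)) :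
    Set (V →₀ ℕ) :=
  {m | Minimal (fun e => MvPolynomial.monomial e (1 : K) ∈ I) m}

/-- `deg(I) = D`: the largest degree among the minimal generators of the monomial ideal `I` is
`D`. -/
def HasDegree {V : Type*} {K : Type*} [Field K] (I : Ideal (MvPolynomial V K)) (D : ℕ) : Prop :=
  IsGreatest (Finsupp.degree '' minimalGenerators I) D

/-! ### Minimal graded free resolutions and regularity -/

/-- The homogeneous component of degree `j ∈ ℤ` of the polynomial ring (zero if `j < 0`). -/
def homogeneousPart (σ K : Type*) [Field K] (j : ℤ) : Submodule K (MvPolynomial σ K) :=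
  if 0 ≤ j then MvPolynomial.homogeneousSubmodule σ K j.toNat else ⊥

/-- The standard grading of `S/I`: its degree-`j` part is the image of the degree-`j` part
of `S`. -/
def quotientGrading {σ K : Type*} [Field K] (I : Ideal (MvPolynomial σ K)) (j : ℤ) :
    Submodule K (MvPolynomial σ K ⧸ I) :=
  (homogeneousPart σ K j).map (Ideal.Quotient.mkₐ K I).toLinearMap

/-- A minimal graded free resolution `⋯ → F₁ → F₀ → M → 0` of a module `M` over the polynomial ring
`S = K[x_i : i ∈ σ]`, where `𝓜 j` is the degree-`j` part of `M`.
The module `F_i` is `⨁_a S(-shift i a)`, a free module of finite rank `rank i` whose `a`-th basis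
vector has degree `shift i a`. All maps are homogeneous of degree zero (it suffices to say so on
basis vectors), and minimality means that the differentials have entries in the maximal ideal
`(x_i : i ∈ σ)`. -/
structure MinimalGradedFreeResolution {σ K M : Type*} [Field K] [AddCommGroup M]
    [Module (MvPolynomial σ K) M] [Module K M] (𝓜 : ℤ → Submodule K M) where
  rank : ℕ → ℕ
  shift : (i : ℕ) → Fin (rank i) → ℤ
  diff : (i : ℕ) →
    (Fin (rank (i + 1)) → MvPolynomial σ K) →ₗ[MvPolynomial σ K] (Fin (rank i) → MvPolynomial σ K)
  aug : (Fin (rank 0) → MvPolynomial σ K) →ₗ[MvPolynomial σ K] M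
  diff_graded : ∀ (i : ℕ) (b : Fin (rank (i + 1))) (a : Fin (rank i)),
    diff i (Pi.single b 1) a ∈ homogeneousPart σ K (shift (i + 1) b - shift i a)
  aug_graded : ∀ a : Fin (rank 0), aug (Pi.single a 1) ∈ 𝓜 (shift 0 a)
  aug_surjective : Function.Surjective aug
  exact_aug : Function.Exact (diff 0) aug
  exact_diff : ∀ i : ℕ, Function.Exact (diff (i + 1)) (diff i)
  minimal : ∀ (i : ℕ) (b : Fin (rank (i + 1))) (a : Fin (rank i)),
    diff i (Pi.single b 1) a ∈ Ideal.span (Set.range (MvPolynomial.X : σ → MvPolynomial σ K))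

/-- The graded Betti number `β_{i,j}`: the number of copies of `S(-j)` in `F_i`. -/
def MinimalGradedFreeResolution.betti {σ K M : Type*} [Field K] [AddCommGroup M]
    [Module (MvPolynomial σ K) M] [Module K M] {𝓜 : ℤ → Submodule K M}
    (F : MinimalGradedFreeResolution (σ := σ) 𝓜) (i : ℕ) (j : ℤ) : ℕ :=
  (Finset.univ.filter fun a => F.shift i a = j).card

/-- `reg(S/I) = r`: the quotient `S/I` has a minimal graded free resolution, and for every such
resolution `r = max {j : β_{i,i+j}(S/I) ≠ 0 for some i}`. -/
def HasRegularity {σ K : Type*} [Field K] (I : Ideal (MvPolynomial σ K)) (r : ℤ) : Prop :=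
  Nonempty (MinimalGradedFreeResolution (σ := σ) (quotientGrading I)) ∧
    ∀ F : MinimalGradedFreeResolution (σ := σ) (quotientGrading I),
      IsGreatest {j : ℤ | ∃ i : ℕ, F.betti i (i + j) ≠ 0} r

end CaterpillarReg

end

noncomputable section

namespace CaterpillarReg

open MvPolynomial

/-! ### Graded free modules over a polynomial ring -/

section GradedFree

variable {σ K : Type*} [Field K]

/-- The homogeneous component of degree `j ∈ ℤ` of a polynomial (zero if `j < 0`). -/
def intComponent (j : ℤ) : MvPolynomial σ K →ₗ[K] MvPolynomial σ K :=
  if 0 ≤ j then homogeneousComponent j.toNat else 0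

theorem coeff_intComponent (j : ℤ) (p : MvPolynomial σ K) (m : σ →₀ ℕ) :
    coeff m (intComponent j p) = if (m.degree : ℤ) = j then coeff m p else 0 := by
  unfold intComponent
  split_ifs with h1 h2 h2
  · rw [coeff_homogeneousComponent, if_pos (by omega)]
  · rw [coeff_homogeneousComponent, if_neg (by omega)]
  · omega
  · simp

theorem mem_homogeneousPart_iff {j : ℤ} {p : MvPolynomial σ K} :
    p ∈ homogeneousPart σ K j ↔ intComponent j p = p := by
  unfold homogeneousPart intComponent
  split_ifs with h
  · constructor
    · intro hp
      exact homogeneousComponent_eq_self hp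
    · intro hp
      rw [← hp]
      exact homogeneousComponent_mem _ _
  · simp [eq_comm]

theorem intComponent_intComponent (j : ℤ) (p : MvPolynomial σ K) :
    intComponent j (intComponent j p) = intComponent j p := by
  ext m
  simp only [coeff_intComponent]
  split_ifs <;> rfl

theorem intComponent_mul {i : ℤ} {p : MvPolynomial σ K} (hp : intComponent i p = p) (j : ℤ)
    (q : MvPolynomial σ K) : intComponent j (q * p) = intComponent (j - i) q * p := by
  classical
  ext m
  rw [coeff_intComponent, coeff_mul, coeff_mul]
  have key : ∀ x ∈ Finset.HasAntidiagonal.antidiagonal m, coeff x.1 (intComponent (j - i) q) * coeff x.2 p =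
      if (m.degree : ℤ) = j then coeff x.1 q * coeff x.2 p else 0 := by
    intro x hx
    rw [Finset.HasAntidiagonal.mem_antidiagonal] at hx
    have hd : m.degree = x.1.degree + x.2.degree := by rw [← hx, map_add]
    by_cases h2 : (x.2.degree : ℤ) = i
    · rw [coeff_intComponent]
      by_cases hm : (m.degree : ℤ) = j
      · rw [if_pos hm, if_pos (by omega)]
      · rw [if_neg hm, if_neg (by omega), zero_mul]
    · have : coeff x.2 p = 0 := by rw [← hp, coeff_intComponent, if_neg h2]
      simp [this]
  rw [Finset.sum_congr rfl key]
  split_ifs <;> simp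

variable {ι κ τ : Type*}

/-- The component of degree `d` of a vector in the graded free module whose `a`-th basis vector
has degree `s a`. -/
def vectorComponent (s : ι → ℤ) (d : ℤ) : (ι → MvPolynomial σ K) →ₗ[K] (ι → MvPolynomial σ K) :=
  LinearMap.pi fun a => intComponent (d - s a) ∘ₗ LinearMap.proj a

@[simp]
theorem vectorComponent_apply (s : ι → ℤ) (d : ℤ) (z : ι → MvPolynomial σ K) (a : ι) :
    vectorComponent s d z a = intComponent (d - s a) (z a) := rfl

theorem vectorComponent_vectorComponent (s : ι → ℤ) (d : ℤ) (z : ι → MvPolynomial σ K) :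
    vectorComponent s d (vectorComponent s d z) = vectorComponent s d z := by
  ext1 a
  simp [intComponent_intComponent]

theorem vectorComponent_smul {s : ι → ℤ} {e : ℤ} {z : ι → MvPolynomial σ K}
    (hz : vectorComponent s e z = z) (d : ℤ) (c : MvPolynomial σ K) :
    vectorComponent s d (c • z) = intComponent (d - e) c • z := by
  ext1 a
  simp only [vectorComponent_apply, Pi.smul_apply, smul_eq_mul]
  rw [intComponent_mul (p := z a) (congrFun hz a)]
  congr 2
  ring_nf

theorem vectorComponent_single [DecidableEq ι] (s : ι → ℤ) (a : ι) :
    vectorComponent s (s a) (Pi.single a (1 : MvPolynomial σ K)) = Pi.single a 1 := by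
  ext1 b
  rw [vectorComponent_apply]
  rcases eq_or_ne b a with rfl | h
  · rw [sub_self, Pi.single_eq_same, ← mem_homogeneousPart_iff]
    rw [homogeneousPart, if_pos le_rfl]
    exact isHomogeneous_one σ K
  · simp [h]

/-- A homomorphism of graded free modules that is homogeneous of degree zero. -/
def IsGraded (t : κ → ℤ) (s : ι → ℤ)
    (f : (κ → MvPolynomial σ K) →ₗ[MvPolynomial σ K] (ι → MvPolynomial σ K)) : Prop :=
  ∀ d z, vectorComponent s d (f z) = f (vectorComponent t d z)

theorem IsGraded.comp {t : κ → ℤ} {s : ι → ℤ} {u : τ → ℤ}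
    {g : (κ → MvPolynomial σ K) →ₗ[MvPolynomial σ K] (ι → MvPolynomial σ K)}
    {f : (τ → MvPolynomial σ K) →ₗ[MvPolynomial σ K] (κ → MvPolynomial σ K)}
    (hg : IsGraded t s g) (hf : IsGraded u t f) : IsGraded u s (g ∘ₗ f) := by
  intro d z
  simp only [LinearMap.comp_apply, hg d, hf d]

theorem IsGraded.add {t : κ → ℤ} {s : ι → ℤ}
    {f g : (κ → MvPolynomial σ K) →ₗ[MvPolynomial σ K] (ι → MvPolynomial σ K)}
    (hf : IsGraded t s f) (hg : IsGraded t s g) : IsGraded t s (f + g) := by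
  intro d z
  simp only [LinearMap.add_apply, map_add, hg d, hf d]

theorem IsGraded.sub {t : κ → ℤ} {s : ι → ℤ}
    {f g : (κ → MvPolynomial σ K) →ₗ[MvPolynomial σ K] (ι → MvPolynomial σ K)}
    (hf : IsGraded t s f) (hg : IsGraded t s g) : IsGraded t s (f - g) := by
  intro d z
  simp only [LinearMap.sub_apply, map_sub, hg d, hf d]

theorem IsGraded.id (s : ι → ℤ) :
    IsGraded s s (LinearMap.id : (ι → MvPolynomial σ K) →ₗ[MvPolynomial σ K] _) :=
  fun _ _ => rfl

theorem IsGraded.vectorComponent_eq {t : κ → ℤ} {s : ι → ℤ}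
    {f : (κ → MvPolynomial σ K) →ₗ[MvPolynomial σ K] (ι → MvPolynomial σ K)}
    (hf : IsGraded t s f) {d : ℤ} {z : κ → MvPolynomial σ K} (hz : vectorComponent t d z = z) :
    vectorComponent s d (f z) = f z := by
  rw [hf, hz]

theorem isGraded_linearCombination [Fintype κ] {t : κ → ℤ} {s : ι → ℤ}
    {w : κ → ι → MvPolynomial σ K} (hw : ∀ k, vectorComponent s (t k) (w k) = w k) :
    IsGraded t s (Fintype.linearCombination (MvPolynomial σ K) w) := by
  intro d z
  simp only [Fintype.linearCombination_apply, map_sum]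
  exact Finset.sum_congr rfl fun k _ => vectorComponent_smul (hw k) d (z k)

theorem linearMap_eq_linearCombination [Fintype κ] [DecidableEq κ] {M : Type*} [AddCommGroup M]
    [Module (MvPolynomial σ K) M] (f : (κ → MvPolynomial σ K) →ₗ[MvPolynomial σ K] M) :
    f = Fintype.linearCombination (MvPolynomial σ K) fun k => f (Pi.single k 1) := by
  refine LinearMap.pi_ext' fun k => LinearMap.ext_ring ?_
  simp [Fintype.linearCombination_apply_single]

theorem isGraded_of_single [Fintype κ] [DecidableEq κ] {t : κ → ℤ} {s : ι → ℤ}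
    {f : (κ → MvPolynomial σ K) →ₗ[MvPolynomial σ K] (ι → MvPolynomial σ K)}
    (hf : ∀ b a, f (Pi.single b 1) a ∈ homogeneousPart σ K (t b - s a)) : IsGraded t s f := by
  rw [linearMap_eq_linearCombination f]
  exact isGraded_linearCombination fun k => funext fun a => mem_homogeneousPart_iff.1 (hf k a)

/-- A submodule of a graded free module generated by homogeneous elements. -/
def IsGradedSubmodule (s : ι → ℤ) (N : Submodule (MvPolynomial σ K) (ι → MvPolynomial σ K)) :
    Prop :=
  ∀ d, ∀ z ∈ N, vectorComponent s d z ∈ N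

theorem IsGraded.isGradedSubmodule_ker {t : κ → ℤ} {s : ι → ℤ}
    {f : (κ → MvPolynomial σ K) →ₗ[MvPolynomial σ K] (ι → MvPolynomial σ K)}
    (hf : IsGraded t s f) : IsGradedSubmodule t (LinearMap.ker f) := by
  intro d z hz
  rw [LinearMap.mem_ker] at hz ⊢
  rw [← hf, hz, map_zero]

/-- Homogeneous elements of the image of a graded map can be lifted to homogeneous elements. -/
theorem IsGraded.exists_lift {t : κ → ℤ} {s : ι → ℤ}
    {f : (κ → MvPolynomial σ K) →ₗ[MvPolynomial σ K] (ι → MvPolynomial σ K)}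
    (hf : IsGraded t s f) {N : Submodule (MvPolynomial σ K) (κ → MvPolynomial σ K)}
    (hN : IsGradedSubmodule t N) {d : ℤ} {y : ι → MvPolynomial σ K} (hy : y ∈ N.map f)
    (hyd : vectorComponent s d y = y) : ∃ z ∈ N, vectorComponent t d z = z ∧ f z = y := by
  obtain ⟨z, hz, rfl⟩ := hy
  exact ⟨vectorComponent t d z, hN d z hz, vectorComponent_vectorComponent t d z,
    by rw [← hf, hyd]⟩

/-- A graded map out of a graded free module lifts along a graded map onto its range. -/
theorem IsGraded.exists_factor [Finite τ] {t : κ → ℤ} {s : ι → ℤ} {u : τ → ℤ}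
    {f : (κ → MvPolynomial σ K) →ₗ[MvPolynomial σ K] (ι → MvPolynomial σ K)}
    (hf : IsGraded t s f) {N : Submodule (MvPolynomial σ K) (κ → MvPolynomial σ K)}
    (hN : IsGradedSubmodule t N)
    {g : (τ → MvPolynomial σ K) →ₗ[MvPolynomial σ K] (ι → MvPolynomial σ K)}
    (hg : IsGraded u s g) (hr : LinearMap.range g ≤ N.map f) :
    ∃ h : (τ → MvPolynomial σ K) →ₗ[MvPolynomial σ K] (κ → MvPolynomial σ K),
      IsGraded u t h ∧ (∀ z, h z ∈ N) ∧ f ∘ₗ h = g := by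
  classical
  have := Fintype.ofFinite τ
  choose w hwN hw hfw using fun k : τ => hf.exists_lift hN
    (hr (LinearMap.mem_range_self g (Pi.single k 1)))
    (hg.vectorComponent_eq (vectorComponent_single u k))
  refine ⟨Fintype.linearCombination _ w, isGraded_linearCombination hw, fun z => ?_, ?_⟩
  · rw [Fintype.linearCombination_apply]
    exact Submodule.sum_mem _ fun k _ => N.smul_mem _ (hwN k)
  · refine LinearMap.pi_ext' fun k => LinearMap.ext_ring ?_
    simp [Fintype.linearCombination_apply_single, hfw]

end GradedFree

/-! ### Degree bounds for syzygies -/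

section SyzygyBound

variable {σ K : Type*} [Field K]

/-- The submodule `N` of a graded free module has the first `n` steps of a graded free resolution
by modules of finite rank, the `i`-th of which has its basis in degrees at most `r + i`. -/
def SyzygyBound : ℕ → ∀ {ι : Type}, (ι → ℤ) →
    Submodule (MvPolynomial σ K) (ι → MvPolynomial σ K) → ℤ → Prop
  | 0, _, _, _, _ => True
  | n + 1, ι, s, N, r => ∃ (κ : Type) (_ : Finite κ) (t : κ → ℤ)
      (g : (κ → MvPolynomial σ K) →ₗ[MvPolynomial σ K] (ι → MvPolynomial σ K)),
      IsGraded t s g ∧ LinearMap.range g = N ∧ (∀ k, t k ≤ r) ∧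
        SyzygyBound n t (LinearMap.ker g) (r + 1)

variable {ι κ κ' : Type}

theorem syzygyBound_bot (n : ℕ) (s : ι → ℤ) (r : ℤ) :
    SyzygyBound (σ := σ) (K := K) n s ⊥ r := by
  induction n generalizing ι r with
  | zero => trivial
  | succ n ih =>
    refine ⟨Empty, inferInstance, fun k => k.elim, 0, fun d z => by simp, by simp,
      fun k => k.elim, ?_⟩
    convert ih _ _
    exact Subsingleton.elim _ _

theorem syzygyBound_top [Finite ι] (n : ℕ) {s : ι → ℤ} {r : ℤ} (hs : ∀ a, s a ≤ r) :
    SyzygyBound (σ := σ) (K := K) n s ⊤ r := by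
  cases n with
  | zero => trivial
  | succ n =>
    refine ⟨ι, inferInstance, s, LinearMap.id, IsGraded.id s, LinearMap.range_id, hs, ?_⟩
    rw [LinearMap.ker_id]
    exact syzygyBound_bot _ _ _

theorem SyzygyBound.map {n : ℕ} {s : ι → ℤ} {t : κ → ℤ} {r : ℤ}
    {N : Submodule (MvPolynomial σ K) (ι → MvPolynomial σ K)} (hN : SyzygyBound n s N r)
    {f : (ι → MvPolynomial σ K) →ₗ[MvPolynomial σ K] (κ → MvPolynomial σ K)}
    (hf : IsGraded s t f) (hinj : ∀ z ∈ N, f z = 0 → z = 0) :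
    SyzygyBound n t (N.map f) r := by
  cases n with
  | zero => trivial
  | succ n =>
    obtain ⟨τ, hτ, u, g, hg, rfl, hu, hB⟩ := hN
    refine ⟨τ, hτ, u, f ∘ₗ g, hf.comp hg, LinearMap.range_comp _ _, hu, ?_⟩
    convert hB using 1
    ext z
    simp only [LinearMap.mem_ker, LinearMap.comp_apply]
    exact ⟨hinj _ ⟨z, rfl⟩, fun h => by rw [h, map_zero]⟩

/-- The inclusion of the first summand of a direct sum of free modules. -/
def inlMap (R : Type*) [CommRing R] (κ κ' : Type*) : (κ → R) →ₗ[R] (κ ⊕ κ' → R) :=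
  LinearMap.pi (Sum.elim LinearMap.proj 0)

@[simp]
theorem inlMap_inl {R : Type*} [CommRing R] {κ κ' : Type*} (z : κ → R) (k : κ) :
    inlMap R κ κ' z (Sum.inl k) = z k := rfl

@[simp]
theorem inlMap_inr {R : Type*} [CommRing R] {κ κ' : Type*} (z : κ → R) (k : κ') :
    inlMap R κ κ' z (Sum.inr k) = 0 := rfl

theorem isGraded_inlMap (t : κ → ℤ) (t' : κ' → ℤ) :
    IsGraded t (Sum.elim t t') (inlMap (MvPolynomial σ K) κ κ') := by
  intro d z
  ext1 (k | k) <;> simp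

/-- The restriction to the first summand, homogeneous of degree zero. -/
theorem isGraded_funLeft_inl (t : κ → ℤ) (t' : κ' → ℤ) :
    IsGraded (Sum.elim t t') t
      (LinearMap.funLeft (MvPolynomial σ K) (MvPolynomial σ K) (Sum.inl : κ → κ ⊕ κ')) :=
  fun _ _ => rfl

theorem isGraded_funLeft_inr (t : κ → ℤ) (t' : κ' → ℤ) :
    IsGraded (Sum.elim t t') t'
      (LinearMap.funLeft (MvPolynomial σ K) (MvPolynomial σ K) (Sum.inr : κ' → κ ⊕ κ')) :=
  fun _ _ => rfl

/-- Horseshoe lemma: an extension of modules with bounded syzygies has bounded syzygies. -/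
theorem SyzygyBound.extension {n : ℕ} : ∀ {ι κ : Type} {s : ι → ℤ} {t : κ → ℤ} {r : ℤ}
    {N : Submodule (MvPolynomial σ K) (ι → MvPolynomial σ K)}
    {f : (ι → MvPolynomial σ K) →ₗ[MvPolynomial σ K] (κ → MvPolynomial σ K)},
    IsGradedSubmodule s N → IsGraded s t f → SyzygyBound n s (N ⊓ LinearMap.ker f) r →
    SyzygyBound n t (N.map f) r → SyzygyBound n s N r := by
  induction n with
  | zero => intros; trivial
  | succ n ih =>
    rintro ι κ s t r N f hN hf ⟨α, hα, u, g, hg, hgN, hu, hgB⟩ ⟨β, hβ, v, q, hq, hqN, hv, hqB⟩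
    obtain ⟨w, hw, hwN, hwq⟩ := hf.exists_factor hN hq hqN.le
    have hgker : ∀ z, g z ∈ N ∧ f (g z) = 0 := fun z => by
      simpa [hgN] using LinearMap.mem_range_self g z
    have hwq' : ∀ z, f (w z) = q z := fun z => LinearMap.congr_fun hwq z
    let S := MvPolynomial σ K
    let p : (α ⊕ β → S) →ₗ[S] (ι → S) :=
      g ∘ₗ LinearMap.funLeft S S Sum.inl + w ∘ₗ LinearMap.funLeft S S Sum.inr
    have hp : IsGraded (Sum.elim u v) s p :=
      (hg.comp (isGraded_funLeft_inl u v)).add (hw.comp (isGraded_funLeft_inr u v))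
    have hpa : ∀ z, p z = g (z ∘ Sum.inl) + w (z ∘ Sum.inr) := fun z => rfl
    refine ⟨α ⊕ β, inferInstance, Sum.elim u v, p, hp, ?_, by rintro (k | k); exacts [hu k, hv k],
      ih hp.isGradedSubmodule_ker (isGraded_funLeft_inr u v) ?_ ?_⟩
    · refine le_antisymm ?_ fun y hy => ?_
      · rintro _ ⟨z, rfl⟩
        exact N.add_mem (hgker _).1 (hwN _)
      · have hfy : f y ∈ LinearMap.range q := hqN ▸ Submodule.mem_map_of_mem hy
        obtain ⟨b, hb⟩ := hfy
        have : y - w b ∈ LinearMap.range g := by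
          rw [hgN]
          refine ⟨N.sub_mem hy (hwN b), ?_⟩
          rw [SetLike.mem_coe, LinearMap.mem_ker, map_sub, hwq', hb, sub_self]
        obtain ⟨a, ha⟩ := this
        refine ⟨Sum.elim a b, ?_⟩
        rw [hpa, Sum.elim_comp_inl, Sum.elim_comp_inr, ha, sub_add_cancel]
    · have := hgB.map (isGraded_inlMap u v) (fun z _ hz => by
        ext1 k
        exact congrFun hz (Sum.inl k))
      convert this using 1
      ext z
      simp only [Submodule.mem_inf, LinearMap.mem_ker, Submodule.mem_map]
      constructor
      · rintro ⟨h1, h2⟩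
        have h2' : z ∘ Sum.inr = 0 := h2
        refine ⟨z ∘ Sum.inl, ?_, ?_⟩
        · rw [hpa, h2', map_zero, add_zero] at h1
          exact h1
        · ext1 (k | k)
          · rfl
          · exact (congrFun h2 k).symm
      · rintro ⟨y, hy, rfl⟩
        refine ⟨?_, rfl⟩
        have h0 : inlMap S α β y ∘ Sum.inr = 0 := rfl
        have h1 : inlMap S α β y ∘ Sum.inl = y := rfl
        rw [hpa, h0, h1, hy, map_zero, add_zero]
    · convert hqB using 1
      ext b
      simp only [Submodule.mem_map, LinearMap.mem_ker]
      constructor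
      · rintro ⟨z, hz, rfl⟩
        have h3 : f (p z) = 0 := by rw [hz, map_zero]
        rw [hpa, map_add, (hgker _).2, zero_add, hwq'] at h3
        exact h3
      · intro hb
        have : -w b ∈ LinearMap.range g := by
          rw [hgN]
          refine ⟨N.neg_mem (hwN b), ?_⟩
          rw [SetLike.mem_coe, LinearMap.mem_ker, map_neg, hwq', hb, neg_zero]
        obtain ⟨a, ha⟩ := this
        refine ⟨Sum.elim a b, ?_, rfl⟩
        rw [hpa, Sum.elim_comp_inl, Sum.elim_comp_inr, ha, neg_add_cancel]

/-- Degree bounds for the syzygies of a module do not depend on the presentation. -/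
theorem SyzygyBound.ker_of_ker [Finite κ] [Finite κ'] {M : Type*} [AddCommGroup M]
    [Module (MvPolynomial σ K) M]
    {n : ℕ} {t : κ → ℤ} {t' : κ' → ℤ} {r : ℤ}
    {q : (κ → MvPolynomial σ K) →ₗ[MvPolynomial σ K] M}
    {q' : (κ' → MvPolynomial σ K) →ₗ[MvPolynomial σ K] M}
    {h : (κ' → MvPolynomial σ K) →ₗ[MvPolynomial σ K] (κ → MvPolynomial σ K)}
    {h' : (κ → MvPolynomial σ K) →ₗ[MvPolynomial σ K] (κ' → MvPolynomial σ K)}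
    (hh : IsGraded t' t h) (hh' : IsGraded t t' h') (hq : ∀ z, q (h z) = q' z)
    (hq' : ∀ z, q' (h' z) = q z) (ht : ∀ k, t k ≤ r + 1) (ht' : ∀ k, t' k ≤ r)
    (hB : SyzygyBound n t (LinearMap.ker q) r) : SyzygyBound n t' (LinearMap.ker q') r := by
  cases n with
  | zero => trivial
  | succ n =>
    obtain ⟨α, hα, u, g, hg, hgN, hu, hgB⟩ := hB
    have hqg : ∀ z, q (g z) = 0 := fun z => by
      simpa [hgN] using LinearMap.mem_range_self g z
    let S := MvPolynomial σ K
    let i : (α ⊕ κ' → S) →ₗ[S] (α → S) := LinearMap.funLeft S S Sum.inl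
    let j : (α ⊕ κ' → S) →ₗ[S] (κ' → S) := LinearMap.funLeft S S Sum.inr
    have hi : IsGraded (Sum.elim u t') u i := isGraded_funLeft_inl u t'
    have hj : IsGraded (Sum.elim u t') t' j := isGraded_funLeft_inr u t'
    let p : (α ⊕ κ' → S) →ₗ[S] (κ' → S) := h' ∘ₗ g ∘ₗ i + (j - h' ∘ₗ h ∘ₗ j)
    have hp : IsGraded (Sum.elim u t') t' p :=
      (hh'.comp (hg.comp hi)).add (hj.sub (hh'.comp (hh.comp hj)))
    have hpa : ∀ z, p z = h' (g (i z)) + (j z - h' (h (j z))) := fun z => rfl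
    let f : (α ⊕ κ' → S) →ₗ[S] (κ → S) := h ∘ₗ j - g ∘ₗ i
    have hf : IsGraded (Sum.elim u t') t f := (hh.comp hj).sub (hg.comp hi)
    have hfa : ∀ z, f z = h (j z) - g (i z) := fun z => rfl
    have hpf : ∀ z, p z = j z - h' (f z) := fun z => by rw [hpa, hfa, map_sub]; abel
    have hia : ∀ a b, i (Sum.elim a b) = a := fun _ _ => rfl
    have hja : ∀ a b, j (Sum.elim a b) = b := fun _ _ => rfl
    refine ⟨α ⊕ κ', inferInstance, Sum.elim u t', p, hp, ?_,
      by rintro (k | k); exacts [hu k, ht' k],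
      SyzygyBound.extension hp.isGradedSubmodule_ker hf ?_ ?_⟩
    · refine le_antisymm ?_ fun y hy => ?_
      · rintro _ ⟨z, rfl⟩
        rw [LinearMap.mem_ker, hpa, map_add, map_sub, hq', hq', hqg, hq, sub_self, add_zero]
      · have : h y ∈ LinearMap.range g := by
          rw [hgN, LinearMap.mem_ker, hq]
          exact hy
        obtain ⟨a, ha⟩ := this
        refine ⟨Sum.elim a y, ?_⟩
        rw [hpa, hia, hja, ha, add_sub_cancel]
    · have := hgB.map (isGraded_inlMap u t') (fun z _ hz => by
        ext1 k
        exact congrFun hz (Sum.inl k))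
      convert this using 1
      ext z
      simp only [Submodule.mem_inf, LinearMap.mem_ker, Submodule.mem_map]
      constructor
      · rintro ⟨h1, h2⟩
        rw [hpf, h2, map_zero, sub_zero] at h1
        rw [hfa, h1, map_zero, zero_sub, neg_eq_zero] at h2
        refine ⟨i z, h2, ?_⟩
        ext1 (k | k)
        · rfl
        · exact (congrFun h1 k).symm
      · rintro ⟨y, hy, rfl⟩
        have h0 : j (inlMap S α κ' y) = 0 := rfl
        have h1 : i (inlMap S α κ' y) = y := rfl
        have h2 : f (inlMap S α κ' y) = 0 := by
          rw [hfa, h0, h1, hy, map_zero, sub_zero]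
        exact ⟨by rw [hpf, h2, h0, map_zero, sub_zero], h2⟩
    · have htop : (LinearMap.ker p).map f = ⊤ := by
        rw [eq_top_iff]
        intro c _
        have : h (h' c) - c ∈ LinearMap.range g := by
          rw [hgN, LinearMap.mem_ker, map_sub, hq, hq', sub_self]
        obtain ⟨a, ha⟩ := this
        have hc : f (Sum.elim a (h' c)) = c := by
          rw [hfa, hia, hja, ha, sub_sub_cancel]
        refine ⟨Sum.elim a (h' c), ?_, hc⟩
        rw [SetLike.mem_coe, LinearMap.mem_ker, hpf, hc, hja, sub_self]
      rw [htop]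
      exact syzygyBound_top n ht

/-- The shifts of a minimal graded cover are bounded by those of any graded cover. -/
theorem shift_le_of_minimal [Finite κ] [Fintype κ'] [DecidableEq κ'] {M : Type*} [AddCommGroup M]
    [Module (MvPolynomial σ K) M] {t : κ → ℤ} {t' : κ' → ℤ} {r : ℤ}
    {q : (κ → MvPolynomial σ K) →ₗ[MvPolynomial σ K] M}
    {q' : (κ' → MvPolynomial σ K) →ₗ[MvPolynomial σ K] M}
    {h : (κ' → MvPolynomial σ K) →ₗ[MvPolynomial σ K] (κ → MvPolynomial σ K)}
    {h' : (κ → MvPolynomial σ K) →ₗ[MvPolynomial σ K] (κ' → MvPolynomial σ K)}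
    (hh' : IsGraded t t' h') (hq : ∀ z, q (h z) = q' z)
    (hq' : ∀ z, q' (h' z) = q z) (ht : ∀ k, t k ≤ r)
    (hmin : ∀ z, q' z = 0 → ∀ k, coeff 0 (z k) = 0) (k : κ') : t' k ≤ r := by
  classical
  have := Fintype.ofFinite κ
  by_contra! hk
  have h0 : ∀ z, h' z k = ∑ l, z l * h' (Pi.single l 1) k := by
    intro z
    conv_lhs => rw [linearMap_eq_linearCombination h']
    simp [Fintype.linearCombination_apply]
  have h1 : ∀ l, coeff 0 (h' (Pi.single l 1) k) = 0 := by
    intro l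
    have h2 := congrFun (hh'.vectorComponent_eq
      (vectorComponent_single (K := K) (σ := σ) t l)) k
    rw [vectorComponent_apply] at h2
    rw [← h2, coeff_intComponent, if_neg]
    have := ht l
    simp only [map_zero, Nat.cast_zero]
    omega
  have h3 := hmin (Pi.single k 1 - h' (h (Pi.single k 1))) (by
    rw [map_sub, hq', hq, sub_self]) k
  rw [Pi.sub_apply, Pi.single_eq_same, h0, coeff_sub, coeff_sum] at h3
  have h4 : ∀ p q : MvPolynomial σ K, coeff 0 (p * q) = coeff 0 p * coeff 0 q := by
    intro p q
    simp only [← constantCoeff_eq, map_mul]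
  simp [h4, h1] at h3

end SyzygyBound

section Splitting

variable {σ K : Type*} [Field K] {ι : Type}

theorem SyzygyBound.of_succ {n : ℕ} : ∀ {ι : Type} {s : ι → ℤ}
    {N : Submodule (MvPolynomial σ K) (ι → MvPolynomial σ K)} {r : ℤ},
    SyzygyBound (n + 1) s N r → SyzygyBound n s N r := by
  induction n with
  | zero => intros; trivial
  | succ n ih =>
    rintro ι s N r ⟨κ, hκ, t, g, hg, hN, ht, hB⟩
    exact ⟨κ, hκ, t, g, hg, hN, ht, ih hB⟩

theorem vectorComponent_shift (s : ι → ℤ) (c d : ℤ) (z : ι → MvPolynomial σ K) :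
    vectorComponent (fun a => s a + c) d z = vectorComponent s (d - c) z := by
  ext1 a
  rw [vectorComponent_apply, vectorComponent_apply, sub_sub, add_comm c]

theorem SyzygyBound.shift {n : ℕ} (c : ℤ) : ∀ {ι : Type} {s : ι → ℤ}
    {N : Submodule (MvPolynomial σ K) (ι → MvPolynomial σ K)} {r : ℤ},
    SyzygyBound n s N r → SyzygyBound n (fun a => s a + c) N (r + c) := by
  induction n with
  | zero => intros; trivial
  | succ n ih =>
    rintro ι s N r ⟨κ, hκ, t, g, hg, hN, ht, hB⟩
    refine ⟨κ, hκ, fun k => t k + c, g, fun d z => ?_, hN, fun k => by linarith [ht k], ?_⟩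
    · rw [vectorComponent_shift, vectorComponent_shift, hg]
    · convert ih hB using 1
      ring

theorem vectorComponent_form_smul {x : MvPolynomial σ K} (hx : intComponent 1 x = x)
    (s : ι → ℤ) (d : ℤ) (z : ι → MvPolynomial σ K) :
    vectorComponent s d (x • z) = x • vectorComponent s (d - 1) z := by
  ext1 a
  simp only [vectorComponent_apply, Pi.smul_apply, smul_eq_mul]
  rw [mul_comm x, intComponent_mul hx, mul_comm x]
  congr 2
  ring_nf

/-- If `N = x J + L` with `x` a linear form, `L ⊆ J` and `L` is `x`-saturated in `J`, then degree
bounds for the syzygies of `J` and `L` give degree bounds for those of `N`. -/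
theorem SyzygyBound.splitting {n : ℕ} {s : ι → ℤ} {r : ℤ} {x : MvPolynomial σ K}
    {N J L : Submodule (MvPolynomial σ K) (ι → MvPolynomial σ K)} (hx : intComponent 1 x = x)
    (hN : ∀ z, z ∈ N ↔ ∃ f ∈ J, ∃ l ∈ L, z = x • f + l) (hLJ : L ≤ J)
    (hsat : ∀ f ∈ J, x • f ∈ L → f ∈ L)
    (hJ : SyzygyBound n s J r) (hL : SyzygyBound n s L (r + 1)) :
    SyzygyBound n s N (r + 1) := by
  cases n with
  | zero => trivial
  | succ n =>
    have hL' := (SyzygyBound.shift 1 hL).of_succ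
    obtain ⟨α, hα, u, g, hg, rfl, hu, hgB⟩ := hJ
    obtain ⟨β, hβ, v, q, hq, rfl, hv, hqB⟩ := hL
    let S := MvPolynomial σ K
    let u' : α → ℤ := fun k => u k + 1
    let i : (α ⊕ β → S) →ₗ[S] (α → S) := LinearMap.funLeft S S Sum.inl
    let j : (α ⊕ β → S) →ₗ[S] (β → S) := LinearMap.funLeft S S Sum.inr
    have hi : IsGraded (Sum.elim u' v) u' i := isGraded_funLeft_inl u' v
    have hj : IsGraded (Sum.elim u' v) v j := isGraded_funLeft_inr u' v
    have hxg : IsGraded u' s (x • g) := by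
      intro d z
      rw [LinearMap.smul_apply, LinearMap.smul_apply, vectorComponent_form_smul hx,
        vectorComponent_shift, hg]
    have hg' : IsGraded u' (fun a => s a + 1) g := by
      intro d z
      rw [vectorComponent_shift, vectorComponent_shift, hg]
    let p : (α ⊕ β → S) →ₗ[S] (ι → S) := (x • g) ∘ₗ i + q ∘ₗ j
    have hp : IsGraded (Sum.elim u' v) s p := (hxg.comp hi).add (hq.comp hj)
    have hpa : ∀ z, p z = x • g (i z) + q (j z) := fun z => rfl
    have hgi : IsGraded (Sum.elim u' v) (fun a => s a + 1) (g ∘ₗ i) := hg'.comp hi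
    have hia : ∀ a b, i (Sum.elim a b) = a := fun _ _ => rfl
    have hja : ∀ a b, j (Sum.elim a b) = b := fun _ _ => rfl
    refine ⟨α ⊕ β, inferInstance, Sum.elim u' v, p, hp, ?_, ?_,
      SyzygyBound.extension hp.isGradedSubmodule_ker hgi ?_ ?_⟩
    · ext z
      rw [hN]
      constructor
      · rintro ⟨y, rfl⟩
        exact ⟨g (i y), ⟨_, rfl⟩, q (j y), ⟨_, rfl⟩, hpa y⟩
      · rintro ⟨_, ⟨a, rfl⟩, _, ⟨b, rfl⟩, rfl⟩
        exact ⟨Sum.elim a b, by rw [hpa, hia, hja]⟩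
    · rintro (k | k)
      · exact add_le_add_left (hu k) 1
      · exact hv k
    · have hmem : ∀ z, z ∈ LinearMap.ker p ⊓ LinearMap.ker (g ∘ₗ i) ↔
          g (i z) = 0 ∧ q (j z) = 0 := by
        intro z
        simp only [Submodule.mem_inf, LinearMap.mem_ker, LinearMap.comp_apply, hpa]
        constructor
        · rintro ⟨h1, h2⟩
          rw [h2, smul_zero, zero_add] at h1
          exact ⟨h2, h1⟩
        · rintro ⟨h1, h2⟩
          rw [h1, h2, smul_zero, zero_add]
          exact ⟨rfl, rfl⟩
      refine SyzygyBound.extension (f := j) (t := v) ?_ hj ?_ ?_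
      · intro d z hz
        rw [hmem] at hz ⊢
        have h1 : i (vectorComponent (Sum.elim u' v) d z) = vectorComponent u' d (i z) := rfl
        have h2 : j (vectorComponent (Sum.elim u' v) d z) = vectorComponent v d (j z) := rfl
        rw [h1, h2, ← hg', ← hq, hz.1, hz.2, map_zero, map_zero]
        exact ⟨rfl, rfl⟩
      · have := (SyzygyBound.shift 1 hgB).map (isGraded_inlMap u' v) (fun z _ hz => by
          ext1 k
          exact congrFun hz (Sum.inl k))
        convert this using 1
        ext z
        rw [Submodule.mem_inf, hmem]
        simp only [LinearMap.mem_ker, Submodule.mem_map]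
        constructor
        · rintro ⟨⟨h1, h2⟩, h3⟩
          refine ⟨i z, h1, ?_⟩
          ext1 (k | k)
          · rfl
          · exact (congrFun h3 k).symm
        · rintro ⟨y, hy, rfl⟩
          have h0 : j (inlMap S α β y) = 0 := rfl
          have h1 : i (inlMap S α β y) = y := rfl
          rw [h0, h1, hy, map_zero]
          exact ⟨⟨rfl, rfl⟩, rfl⟩
      · convert hqB using 1
        ext b
        simp only [Submodule.mem_map, LinearMap.mem_ker, hmem]
        constructor
        · rintro ⟨z, ⟨-, hz⟩, rfl⟩
          exact hz
        · intro hb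
          refine ⟨Sum.elim 0 b, ?_, hja _ _⟩
          rw [hia, hja, hb, map_zero]
          exact ⟨rfl, rfl⟩
    · convert hL' using 1
      ext y
      simp only [Submodule.mem_map, LinearMap.mem_ker, LinearMap.comp_apply]
      constructor
      · rintro ⟨z, hz, rfl⟩
        refine hsat _ ⟨_, rfl⟩ ⟨-j z, ?_⟩
        rw [hpa] at hz
        rw [map_neg]
        exact (eq_neg_of_add_eq_zero_left hz).symm
      · intro hy
        obtain ⟨a, rfl⟩ := hLJ hy
        obtain ⟨b, hb⟩ := hy
        refine ⟨Sum.elim a (-x • b), ?_, by rw [hia]⟩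
        rw [hpa, hia, hja, map_smul, hb, neg_smul, add_neg_cancel]

end Splitting

section MinimalCover

variable {σ K : Type*} [Field K] {ι : Type}

theorem mem_span_vectorComponent [Finite ι] (s : ι → ℤ) (z : ι → MvPolynomial σ K) :
    z ∈ Submodule.span (MvPolynomial σ K) (Set.range fun d => vectorComponent s d z) := by
  classical
  have := Fintype.ofFinite ι
  let T : Finset ℤ := Finset.univ.biUnion fun a : ι =>
    (Finset.range ((z a).totalDegree + 1)).image fun j : ℕ => (j : ℤ) + s a
  have hz : z = ∑ d ∈ T, vectorComponent s d z := by
    ext a m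
    rw [Finset.sum_apply, coeff_sum]
    simp only [vectorComponent_apply, coeff_intComponent]
    by_cases hm : coeff m (z a) = 0
    · simp [hm]
    · have hT : (m.degree : ℤ) + s a ∈ T := by
        refine Finset.mem_biUnion.2 ⟨a, Finset.mem_univ _, Finset.mem_image.2 ⟨m.degree, ?_, rfl⟩⟩
        rw [Finset.mem_range, Nat.lt_succ_iff]
        exact le_totalDegree (mem_support_iff.2 hm)
      rw [Finset.sum_eq_single_of_mem _ hT]
      · simp
      · intro d _ hd
        rw [if_neg]
        omega
  rw [hz]
  refine Submodule.sum_mem _ fun d _ => ?_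
  rw [← hz]
  exact Submodule.subset_span ⟨d, rfl⟩

theorem IsGradedSubmodule.exists_cover [Finite σ] [Finite ι] {s : ι → ℤ}
    {N : Submodule (MvPolynomial σ K) (ι → MvPolynomial σ K)} (hN : IsGradedSubmodule s N) :
    ∃ (k : ℕ) (t : Fin k → ℤ) (w : Fin k → ι → MvPolynomial σ K),
      (∀ a, vectorComponent s (t a) (w a) = w a) ∧
        Submodule.span (MvPolynomial σ K) (Set.range w) = N := by
  let H : Set (ι → MvPolynomial σ K) := {z | z ∈ N ∧ ∃ d, vectorComponent s d z = z}
  have hH : Submodule.span (MvPolynomial σ K) H = N := by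
    refine le_antisymm (Submodule.span_le.2 fun z hz => hz.1) fun z hz => ?_
    refine Submodule.span_mono ?_ (mem_span_vectorComponent s z)
    rintro _ ⟨d, rfl⟩
    exact ⟨hN d z hz, d, vectorComponent_vectorComponent s d z⟩
  have hfg : (Submodule.span (MvPolynomial σ K) H).FG := IsNoetherian.noetherian _
  obtain ⟨T, hTH, hT⟩ := (Submodule.fg_span_iff_fg_span_finset_subset H).1 hfg
  choose d hd using fun a : Fin T.card => (hTH (T.equivFin.symm a).2).2
  refine ⟨T.card, d, fun a => (T.equivFin.symm a : ι → MvPolynomial σ K), hd, ?_⟩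
  rw [← hH, hT]
  congr 1
  ext z
  constructor
  · rintro ⟨a, rfl⟩
    exact (T.equivFin.symm a).2
  · intro hz
    exact ⟨T.equivFin ⟨z, hz⟩, by simp⟩

/-- Every graded submodule of a graded free module of finite rank has a minimal graded cover. -/
theorem IsGradedSubmodule.exists_minimal_cover [Finite σ] [Finite ι] {s : ι → ℤ}
    {N : Submodule (MvPolynomial σ K) (ι → MvPolynomial σ K)} (hN : IsGradedSubmodule s N) :
    ∃ (k : ℕ) (t : Fin k → ℤ)
      (g : (Fin k → MvPolynomial σ K) →ₗ[MvPolynomial σ K] (ι → MvPolynomial σ K)),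
      IsGraded t s g ∧ LinearMap.range g = N ∧ ∀ z, g z = 0 → ∀ a, coeff 0 (z a) = 0 := by
  classical
  have hex := hN.exists_cover
  obtain ⟨t, w, hw, hspan⟩ := Nat.find_spec hex
  have hmin := fun m => Nat.find_min hex (m := m)
  generalize Nat.find hex = k at t w hw hspan hmin
  have hg := isGraded_linearCombination hw
  refine ⟨k, t, _, hg, by rw [Fintype.range_linearCombination, hspan], fun z hz a => ?_⟩
  by_contra hza
  obtain ⟨k, rfl⟩ : ∃ m, k = m + 1 := ⟨k - 1, by have := a.2; omega⟩
  refine hmin k (Nat.lt_succ_self k) ⟨t ∘ a.succAbove, w ∘ a.succAbove, fun b => hw _, ?_⟩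
  rw [← hspan]
  refine le_antisymm (Submodule.span_mono (Set.range_comp_subset_range _ _)) ?_
  rw [Submodule.span_le]
  have hb : ∀ b, w (a.succAbove b) ∈
      Submodule.span (MvPolynomial σ K) (Set.range (w ∘ a.succAbove)) :=
    fun b => Submodule.subset_span ⟨b, rfl⟩
  have hwa : w a ∈ Submodule.span (MvPolynomial σ K) (Set.range (w ∘ a.succAbove)) := by
    have h1 : Fintype.linearCombination (MvPolynomial σ K) w (vectorComponent t (t a) z) = 0 := by
      rw [← hg, hz, map_zero]
    rw [Fintype.linearCombination_apply, Fin.sum_univ_succAbove _ a] at h1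
    have h2 : vectorComponent t (t a) z a = C (coeff 0 (z a)) := by
      rw [vectorComponent_apply, sub_self]
      simp [intComponent, homogeneousComponent_zero]
    have h3 : w a = (C (coeff 0 (z a))⁻¹ : MvPolynomial σ K) • (vectorComponent t (t a) z a • w a) := by
      rw [h2, smul_smul, ← C_mul, inv_mul_cancel₀ hza, C_1, one_smul]
    rw [h3, eq_neg_of_add_eq_zero_left h1]
    refine Submodule.smul_mem _ _ (Submodule.neg_mem _ (Submodule.sum_mem _ fun b _ => ?_))
    exact Submodule.smul_mem _ _ (hb b)
  rintro _ ⟨b, rfl⟩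
  rcases eq_or_ne b a with rfl | hne
  · exact hwa
  · obtain ⟨c, rfl⟩ := Fin.exists_succAbove_eq hne
    exact hb c

end MinimalCover

section Regularity

variable {σ K : Type*} [Field K]

/-- An ideal as a submodule of the free module of rank one. -/
def idealModule (I : Ideal (MvPolynomial σ K)) :
    Submodule (MvPolynomial σ K) (Fin 1 → MvPolynomial σ K) :=
  Submodule.comap (LinearMap.proj 0 : (Fin 1 → MvPolynomial σ K) →ₗ[MvPolynomial σ K] _) I

theorem mem_idealModule {I : Ideal (MvPolynomial σ K)} {z : Fin 1 → MvPolynomial σ K} :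
    z ∈ idealModule I ↔ z 0 ∈ I := Iff.rfl

theorem mem_span_X_iff {p : MvPolynomial σ K} :
    p ∈ Ideal.span (Set.range (X : σ → MvPolynomial σ K)) ↔ coeff 0 p = 0 := by
  have := mem_pow_idealOfVars_iff' (σ := σ) (R := K) 1 p
  rw [pow_one] at this
  rw [show Ideal.span (Set.range (X : σ → MvPolynomial σ K)) = idealOfVars σ K from rfl, this]
  constructor
  · intro h
    exact h 0 (by simp)
  · intro h x hx
    rw [Nat.lt_one_iff, Finsupp.degree_eq_zero_iff] at hx
    rw [hx, h]

theorem coeff_zero_mul (p q : MvPolynomial σ K) :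
    coeff 0 (p * q) = coeff 0 p * coeff 0 q := by
  simp only [← constantCoeff_eq, map_mul]

/-- A graded submodule of a graded free module of rank `rank` whose elements have entries without
constant term. -/
structure SyzygyModule (σ K : Type*) [Field K] where
  rank : ℕ
  shift : Fin rank → ℤ
  carrier : Submodule (MvPolynomial σ K) (Fin rank → MvPolynomial σ K)
  graded : IsGradedSubmodule shift carrier
  minimal : ∀ z ∈ carrier, ∀ a, coeff 0 (z a) = 0

namespace SyzygyModule

variable [Finite σ] (N : SyzygyModule σ K)

/-- The rank of a minimal cover. -/
def coverRank : ℕ := N.graded.exists_minimal_cover.choose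

/-- The degrees of the generators of a minimal cover. -/
def coverShift : Fin N.coverRank → ℤ := N.graded.exists_minimal_cover.choose_spec.choose

/-- A minimal cover. -/
def cover :
    (Fin N.coverRank → MvPolynomial σ K) →ₗ[MvPolynomial σ K] (Fin N.rank → MvPolynomial σ K) :=
  N.graded.exists_minimal_cover.choose_spec.choose_spec.choose

theorem isGraded_cover : IsGraded N.coverShift N.shift N.cover :=
  N.graded.exists_minimal_cover.choose_spec.choose_spec.choose_spec.1

theorem range_cover : LinearMap.range N.cover = N.carrier :=
  N.graded.exists_minimal_cover.choose_spec.choose_spec.choose_spec.2.1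

/-- The module of relations of a minimal cover. -/
def next : SyzygyModule σ K where
  rank := N.coverRank
  shift := N.coverShift
  carrier := LinearMap.ker N.cover
  graded := N.isGraded_cover.isGradedSubmodule_ker
  minimal := fun z hz => N.graded.exists_minimal_cover.choose_spec.choose_spec.choose_spec.2.2 z hz

/-- The iterated syzygy modules. -/
def iter : ℕ → SyzygyModule σ K
  | 0 => N
  | n + 1 => (iter n).next

end SyzygyModule

theorem vectorComponent_mem_homogeneousPart {ι κ : Type*} [DecidableEq κ] {t : κ → ℤ} {s : ι → ℤ}
    {f : (κ → MvPolynomial σ K) →ₗ[MvPolynomial σ K] (ι → MvPolynomial σ K)}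
    (hf : IsGraded t s f) (b : κ) (a : ι) :
    f (Pi.single b 1) a ∈ homogeneousPart σ K (t b - s a) :=
  mem_homogeneousPart_iff.2
    (congrFun (hf.vectorComponent_eq (vectorComponent_single (K := K) (σ := σ) t b)) a)

/-- A homogeneous proper ideal has a minimal graded free resolution. -/
theorem nonempty_minimalGradedFreeResolution [Finite σ] {I : Ideal (MvPolynomial σ K)}
    (hI : IsGradedSubmodule (fun _ => 0) (idealModule I)) (h0 : ∀ p ∈ I, coeff 0 p = 0) :
    Nonempty (MinimalGradedFreeResolution (σ := σ) (quotientGrading I)) := by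
  let N : SyzygyModule σ K :=
    { rank := 1
      shift := fun _ => 0
      carrier := idealModule I
      graded := hI
      minimal := fun z hz a => by
        rw [Subsingleton.elim a 0]
        exact h0 _ hz }
  refine ⟨{ rank := fun i => (N.iter i).rank
            shift := fun i => (N.iter i).shift
            diff := fun i => (N.iter i).cover
            aug := Submodule.mkQ I ∘ₗ LinearMap.proj (0 : Fin 1)
            diff_graded := fun i b a => vectorComponent_mem_homogeneousPart
              (N.iter i).isGraded_cover b a
            aug_graded := ?_
            aug_surjective := ?_
            exact_aug := ?_
            exact_diff := ?_
            minimal := ?_ }⟩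
  · intro a
    refine ⟨1, ?_, ?_⟩
    · change (1 : MvPolynomial σ K) ∈ homogeneousPart σ K 0
      rw [homogeneousPart, if_pos le_rfl]
      exact isHomogeneous_one σ K
    · change Fin 1 at a
      rw [Subsingleton.elim a 0]
      rfl
  · intro y
    obtain ⟨p, rfl⟩ := Submodule.mkQ_surjective I y
    exact ⟨fun _ => p, rfl⟩
  · intro z
    refine Iff.trans ?_ (SetLike.ext_iff.1 (N.iter 0).range_cover z).symm
    exact Submodule.Quotient.mk_eq_zero I
  · intro i z
    exact (SetLike.ext_iff.1 (N.iter (i + 1)).range_cover z).symm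
  · intro i b a
    rw [mem_span_X_iff]
    refine (N.iter i).minimal _ ?_ a
    rw [← (N.iter i).range_cover]
    exact LinearMap.mem_range_self _ _

section

variable {I : Ideal (MvPolynomial σ K)}
  (F : MinimalGradedFreeResolution (σ := σ) (quotientGrading I))

theorem MinimalGradedFreeResolution.isGraded_diff (i : ℕ) :
    IsGraded (F.shift (i + 1)) (F.shift i) (F.diff i) :=
  isGraded_of_single (F.diff_graded i)

theorem MinimalGradedFreeResolution.coeff_zero_diff (i : ℕ) (z) (a) :
    coeff 0 (F.diff i z a) = 0 := by
  rw [linearMap_eq_linearCombination (F.diff i), Fintype.linearCombination_apply,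
    Finset.sum_apply, coeff_sum]
  refine Finset.sum_eq_zero fun b _ => ?_
  rw [Pi.smul_apply, smul_eq_mul, coeff_zero_mul, mem_span_X_iff.1 (F.minimal i b a), mul_zero]

/-- Comparison of the augmentation of a resolution of `S/I` with the projection `S → S/I`. -/
theorem MinimalGradedFreeResolution.exists_comparison
    (hI : IsGradedSubmodule (fun _ => 0) (idealModule I)) :
    ∃ (h : (Fin (F.rank 0) → MvPolynomial σ K) →ₗ[MvPolynomial σ K] (Fin 1 → MvPolynomial σ K))
      (h' : (Fin 1 → MvPolynomial σ K) →ₗ[MvPolynomial σ K] (Fin (F.rank 0) → MvPolynomial σ K)),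
      IsGraded (F.shift 0) (fun _ => 0) h ∧ IsGraded (fun _ => 0) (F.shift 0) h' ∧
      (∀ z, Submodule.mkQ I (h z 0) = F.aug z) ∧ (∀ z, F.aug (h' z) = Submodule.mkQ I (z 0)) := by
  choose p hp hpa using F.aug_graded
  let h : (Fin (F.rank 0) → MvPolynomial σ K) →ₗ[MvPolynomial σ K] (Fin 1 → MvPolynomial σ K) :=
    Fintype.linearCombination (MvPolynomial σ K) fun a _ => p a
  have hh : IsGraded (F.shift 0) (fun _ => 0) h := by
    refine isGraded_linearCombination fun a => funext fun b => ?_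
    rw [vectorComponent_apply, sub_zero]
    exact mem_homogeneousPart_iff.1 (hp a)
  have hha : ∀ z, Submodule.mkQ I (h z 0) = F.aug z := by
    intro z
    rw [linearMap_eq_linearCombination F.aug]
    simp only [h, Fintype.linearCombination_apply, Finset.sum_apply, map_sum, Pi.smul_apply,
      map_smul]
    exact Finset.sum_congr rfl fun a _ => congrArg _ (hpa a)
  obtain ⟨y, hy⟩ := F.aug_surjective (Submodule.mkQ I 1)
  let y0 := vectorComponent (F.shift 0) 0 y
  have hy0 : F.aug y0 = Submodule.mkQ I 1 := by
    have h1 : h y - Pi.single 0 1 ∈ idealModule I := by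
      rw [mem_idealModule, Pi.sub_apply, Pi.single_eq_same, ← Submodule.Quotient.mk_eq_zero,
        Submodule.Quotient.mk_sub, sub_eq_zero]
      exact (hha y).trans hy
    have h2 := hI 0 _ h1
    rw [map_sub, hh, vectorComponent_single (K := K) (σ := σ) (fun _ : Fin 1 => 0) 0,
      mem_idealModule, Pi.sub_apply, Pi.single_eq_same, ← Submodule.Quotient.mk_eq_zero,
      Submodule.Quotient.mk_sub, sub_eq_zero] at h2
    exact (hha y0).symm.trans h2
  refine ⟨h, Fintype.linearCombination (MvPolynomial σ K) fun _ => y0, hh,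
    isGraded_linearCombination fun _ => vectorComponent_vectorComponent _ _ _, hha, fun z => ?_⟩
  rw [Fintype.linearCombination_apply, Fin.sum_univ_one, map_smul, hy0, ← map_smul, smul_eq_mul,
    mul_one]

theorem MinimalGradedFreeResolution.shift_le {D : ℤ} (hD : 1 ≤ D)
    (hI : IsGradedSubmodule (fun _ => 0) (idealModule I))
    (hB : ∀ n, SyzygyBound n (fun _ => 0) (idealModule I) D) (i : ℕ) :
    (∀ a, F.shift i a ≤ i + D - 1) ∧
      ∀ n, SyzygyBound n (F.shift i) (LinearMap.range (F.diff i)) (i + D) := by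
  induction i with
  | zero =>
    obtain ⟨h, h', hh, hh', hha, hha'⟩ := F.exists_comparison hI
    have hker : LinearMap.ker (Submodule.mkQ I ∘ₗ LinearMap.proj (0 : Fin 1)) = idealModule I := by
      ext z
      simp only [LinearMap.mem_ker, LinearMap.comp_apply, LinearMap.proj_apply,
        Submodule.mkQ_apply, Submodule.Quotient.mk_eq_zero]
      rfl
    have hr := LinearMap.exact_iff.1 F.exact_aug
    have hs : ∀ a, F.shift 0 a ≤ 0 := by
      refine shift_le_of_minimal (q := Submodule.mkQ I ∘ₗ LinearMap.proj (0 : Fin 1)) hh' hha hha'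
        (fun _ => le_rfl) fun z hz a => ?_
      obtain ⟨y, rfl⟩ := (F.exact_aug z).1 hz
      exact F.coeff_zero_diff 0 y a
    refine ⟨fun a => by have := hs a; push_cast; omega, fun n => ?_⟩
    rw [← hr]
    refine SyzygyBound.ker_of_ker (q := Submodule.mkQ I ∘ₗ LinearMap.proj (0 : Fin 1)) hh hh'
      hha hha' (fun _ => by push_cast; omega) (fun a => by have := hs a; push_cast; omega) ?_
    rw [hker]
    convert hB n using 1
    simp
  | succ i ih =>
    obtain ⟨-, hB⟩ := ih
    have key : ∀ n, (∀ a, F.shift (i + 1) a ≤ i + D) ∧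
        SyzygyBound n (F.shift (i + 1)) (LinearMap.ker (F.diff i)) (i + D + 1) := by
      intro n
      obtain ⟨κ, hκ, t, g, hg, hgN, ht, hgB⟩ := hB (n + 1)
      have hd := F.isGraded_diff i
      have htop : ∀ {κ : Type} (t : κ → ℤ),
          IsGradedSubmodule t (⊤ : Submodule (MvPolynomial σ K) (κ → MvPolynomial σ K)) :=
        fun _ _ _ _ => trivial
      obtain ⟨h, hh, -, hhd⟩ := hg.exists_factor (htop t) hd (by
        rw [← hgN, LinearMap.range_eq_map])
      obtain ⟨h', hh', -, hhd'⟩ := hd.exists_factor (htop _) hg (by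
        rw [hgN, LinearMap.range_eq_map])
      have hs : ∀ a, F.shift (i + 1) a ≤ i + D := by
        refine shift_le_of_minimal hh' (LinearMap.congr_fun hhd) (LinearMap.congr_fun hhd') ht
          fun z hz a => ?_
        obtain ⟨y, rfl⟩ := (F.exact_diff i z).1 hz
        exact F.coeff_zero_diff (i + 1) y a
      exact ⟨hs, SyzygyBound.ker_of_ker hh hh' (LinearMap.congr_fun hhd)
        (LinearMap.congr_fun hhd') (fun k => (ht k).trans (by omega))
        (fun a => (hs a).trans (by omega)) hgB⟩
    refine ⟨fun a => by have := (key 0).1 a; push_cast; omega, fun n => ?_⟩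
    rw [← LinearMap.exact_iff.1 (F.exact_diff i)]
    convert (key n).2 using 1
    push_cast
    ring

/-- Every minimal generator of a monomial ideal contributes a basis vector of its degree to the
first step of a minimal resolution. -/
theorem MinimalGradedFreeResolution.exists_shift_eq
    (hI : IsGradedSubmodule (fun _ => 0) (idealModule I)) (h0 : ∀ p ∈ I, coeff 0 p = 0)
    (hmon : ∀ p ∈ I, ∀ m ∈ p.support, monomial m (1 : K) ∈ I) {m : σ →₀ ℕ}
    (hm : m ∈ minimalGenerators I) : ∃ b, F.shift 1 b = (m.degree : ℤ) := by
  classical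
  have hm' : Minimal (fun e => monomial e (1 : K) ∈ I) m := hm
  by_contra! hne
  obtain ⟨h, h', hh, hh', hha, hha'⟩ := F.exists_comparison hI
  set y := h' (Pi.single 0 1) with hy
  have hyd : vectorComponent (F.shift 0) 0 y = y :=
    hh'.vectorComponent_eq (vectorComponent_single (K := K) (σ := σ) (fun _ : Fin 1 => 0) 0)
  have hy1 : coeff 0 (h y 0) = 1 := by
    have h1 : h y 0 - 1 ∈ I := by
      rw [← Submodule.Quotient.mk_eq_zero, Submodule.Quotient.mk_sub, sub_eq_zero]
      refine (hha y).trans ((hha' _).trans ?_)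
      rw [Pi.single_eq_same]
      rfl
    have h2 := h0 _ h1
    rw [coeff_sub, sub_eq_zero, coeff_zero_one] at h2
    exact h2
  have haug : ∀ z, F.aug z = 0 ↔ h z 0 ∈ I := by
    intro z
    rw [← hha z, Submodule.mkQ_apply, Submodule.Quotient.mk_eq_zero]
  have hker : F.aug (monomial m (1 : K) • y) = 0 := by
    rw [haug, map_smul, Pi.smul_apply, smul_eq_mul]
    exact I.mul_mem_right _ hm'.prop
  obtain ⟨c, hc⟩ := (F.exact_aug _).1 hker
  have hmd : intComponent (m.degree : ℤ) (monomial m (1 : K)) = monomial m 1 := by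
    ext e
    rw [coeff_intComponent, coeff_monomial]
    split_ifs with h1 h2 h2
    · rfl
    · rfl
    · exact absurd (by rw [h2]) h1
    · rfl
  have hcd : F.diff 0 (vectorComponent (F.shift 1) m.degree c) = monomial m (1 : K) • y := by
    rw [← F.isGraded_diff 0, hc, vectorComponent_smul hyd, sub_zero, hmd]
  have h1 := congrArg (fun w => coeff m (h w 0)) hcd
  rw [linearMap_eq_linearCombination (F.diff 0)] at h1
  simp only [Fintype.linearCombination_apply, map_sum, map_smul, Finset.sum_apply, Pi.smul_apply,
    smul_eq_mul, coeff_sum] at h1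
  have h2 : coeff m (monomial m (1 : K) * h y 0) = 1 := by
    have := coeff_monomial_mul 0 m (1 : K) (h y 0)
    rw [add_zero] at this
    rw [this, hy1, mul_one]
  rw [h2] at h1
  refine zero_ne_one (α := K) (Eq.trans (Finset.sum_eq_zero fun b _ => ?_).symm h1)
  rw [coeff_mul]
  refine Finset.sum_eq_zero fun x hx => ?_
  rw [Finset.HasAntidiagonal.mem_antidiagonal] at hx
  by_contra hne0
  have hx1 := left_ne_zero_of_mul hne0
  have hx2 := right_ne_zero_of_mul hne0
  have hx2I : monomial x.2 (1 : K) ∈ I := by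
    refine hmon _ ?_ _ (mem_support_iff.2 hx2)
    rw [← haug]
    exact (F.exact_aug _).2 ⟨_, rfl⟩
  have hle : m ≤ x.2 := hm'.le_of_le hx2I (hx ▸ le_add_self)
  have hx10 : x.1 = 0 := by
    have h3 : x.1 + x.2 ≤ 0 + x.2 := by rw [hx, zero_add]; exact hle
    exact le_antisymm (le_of_add_le_add_right h3) zero_le
  rw [hx10, vectorComponent_apply, coeff_intComponent] at hx1
  refine hx1 (if_neg ?_)
  have := hne b
  simp only [map_zero, Nat.cast_zero]
  omega

theorem hasRegularity_of_syzygyBound [Finite σ] {D : ℕ} (hD : 1 ≤ D)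
    (hI : IsGradedSubmodule (fun _ => 0) (idealModule I)) (h0 : ∀ p ∈ I, coeff 0 p = 0)
    (hmon : ∀ p ∈ I, ∀ m ∈ p.support, monomial m (1 : K) ∈ I)
    (hB : ∀ n, SyzygyBound n (fun _ => 0) (idealModule I) D)
    (hm : ∃ m ∈ minimalGenerators I, m.degree = D) : HasRegularity I ((D : ℤ) - 1) := by
  refine ⟨nonempty_minimalGradedFreeResolution hI h0, fun F => ⟨⟨1, ?_⟩, ?_⟩⟩
  · obtain ⟨m, hm, rfl⟩ := hm
    obtain ⟨b, hb⟩ := F.exists_shift_eq hI h0 hmon hm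
    refine Finset.card_ne_zero.2 ⟨b, Finset.mem_filter.2 ⟨Finset.mem_univ _, ?_⟩⟩
    rw [hb]
    push_cast
    ring
  · rintro j ⟨i, hij⟩
    obtain ⟨a, ha⟩ := Finset.card_ne_zero.1 hij
    have h1 := (Finset.mem_filter.1 ha).2
    have h2 := (F.shift_le (by exact_mod_cast hD) hI hB i).1 a
    omega

end
end Regularity

open scoped Pointwise

/-! ### Squarefree monomial ideals and decision trees -/

section Decision

variable {V : Type*} [DecidableEq V]

/-- The predicate `U` on finite sets can be decided by querying membership of single elements in
such a way that at most `D` queries are answered positively unless `U` is found to fail. -/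
inductive Decision : (Finset V → Prop) → ℕ → Prop
  | never {U : Finset V → Prop} {D : ℕ} (h : ∀ A, ¬ U A) : Decision U D
  | always {U : Finset V → Prop} {D : ℕ} (h : ∀ A, U A) : Decision U D
  | query {U : Finset V → Prop} {D : ℕ} (v : V) (h₁ : Decision (fun A => U (insert v A)) D)
      (h₂ : Decision (fun A => U (A.erase v)) (D + 1)) : Decision U (D + 1)

theorem Decision.mono {U : Finset V → Prop} {D D' : ℕ} (h : Decision U D) (hD : D ≤ D') :
    Decision U D' := by
  induction h generalizing D' with
  | never h => exact .never h
  | always h => exact .always h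
  | query v h₁ h₂ ih₁ ih₂ =>
    obtain ⟨E, rfl⟩ : ∃ E, D' = E + 1 := ⟨D' - 1, by omega⟩
    exact .query v (ih₁ (by omega)) (ih₂ hD)

theorem Decision.card_le {U : Finset V → Prop} {D : ℕ} (h : Decision U D) {A : Finset V}
    (hA : Minimal U A) : A.card ≤ D := by
  induction h generalizing A with
  | never h => exact absurd hA.prop (h A)
  | always h =>
    have : A ⊆ ∅ := hA.le_of_le (h ∅) (Finset.empty_subset A)
    simp [Finset.subset_empty.1 this]
  | @query U D v h₁ h₂ ih₁ ih₂ =>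
    by_cases hv : v ∈ A
    · rw [← Finset.card_erase_add_one hv]
      refine Nat.succ_le_succ (ih₁ ⟨?_, fun B hB hBA => ?_⟩)
      · change U _
        rw [Finset.insert_erase hv]
        exact hA.prop
      · have h := hA.le_of_le hB
          (Finset.insert_subset hv (hBA.trans (Finset.erase_subset v A)))
        exact Finset.subset_insert_iff.1 h
    · refine ih₂ ⟨?_, fun B hB hBA => ?_⟩
      · change U _
        rw [Finset.erase_eq_of_notMem hv]
        exact hA.prop
      · exact (hA.le_of_le hB ((Finset.erase_subset v B).trans hBA)).trans
          (Finset.erase_subset v B)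

end Decision

section SupportIdeal

variable {V : Type*} {K : Type*} [Field K]

/-- The exponent of the squarefree monomial `x_A`. -/
def finsetExponent (A : Finset V) : V →₀ ℕ := ∑ u ∈ A, Finsupp.single u 1

theorem finsetExponent_apply [DecidableEq V] (A : Finset V) (v : V) :
    finsetExponent A v = if v ∈ A then 1 else 0 := by
  simp [finsetExponent, Finsupp.finsetSum_apply, Finsupp.single_apply]

theorem support_finsetExponent (A : Finset V) : (finsetExponent A).support = A := by
  classical
  ext v
  simp [finsetExponent_apply]

theorem degree_finsetExponent (A : Finset V) : (finsetExponent A).degree = A.card := by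
  simp [finsetExponent]

theorem finsetExponent_le_iff {A : Finset V} {m : V →₀ ℕ} :
    finsetExponent A ≤ m ↔ A ⊆ m.support := by
  classical
  constructor
  · intro h
    rw [← support_finsetExponent A]
    exact Finsupp.support_mono h
  · intro h v
    rw [finsetExponent_apply]
    split_ifs with hv
    · exact Nat.one_le_iff_ne_zero.2 (Finsupp.mem_support_iff.1 (h hv))
    · exact Nat.zero_le _

theorem sqfreeMonomial_eq (A : Finset V) :
    sqfreeMonomial K A = monomial (finsetExponent A) 1 := by
  rw [sqfreeMonomial, finsetExponent, monomial_sum_one]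
  rfl

/-- The ideal generated by the squarefree monomials `x_A` with `U A`. -/
def supportIdeal (K : Type*) [Field K] (U : Finset V → Prop) : Ideal (MvPolynomial V K) :=
  Ideal.span (sqfreeMonomial K '' {A | U A})

variable {U : Finset V → Prop}

theorem mem_supportIdeal_iff (hU : Monotone U) {p : MvPolynomial V K} :
    p ∈ supportIdeal K U ↔ ∀ m ∈ p.support, U m.support := by
  have h : sqfreeMonomial K '' {A | U A} =
      (fun e => monomial e (1 : K)) '' (finsetExponent '' {A | U A}) := by
    rw [Set.image_image]
    exact Set.image_congr fun A _ => sqfreeMonomial_eq A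
  rw [supportIdeal, h, mem_ideal_span_monomial_image]
  refine forall₂_congr fun m _ => ?_
  constructor
  · rintro ⟨_, ⟨A, hA, rfl⟩, hm⟩
    exact hU (finsetExponent_le_iff.1 hm) hA
  · intro h
    exact ⟨_, ⟨_, h, rfl⟩, finsetExponent_le_iff.2 subset_rfl⟩

theorem monomial_mem_supportIdeal_iff (hU : Monotone U) {m : V →₀ ℕ} :
    monomial m (1 : K) ∈ supportIdeal K U ↔ U m.support := by
  classical
  rw [mem_supportIdeal_iff hU, support_monomial, if_neg one_ne_zero]
  simp

theorem isGradedSubmodule_supportIdeal (hU : Monotone U) :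
    IsGradedSubmodule (fun _ => 0) (idealModule (supportIdeal K U)) := by
  intro d z hz
  rw [mem_idealModule, mem_supportIdeal_iff hU] at hz ⊢
  intro m hm
  refine hz m ?_
  rw [mem_support_iff, vectorComponent_apply, coeff_intComponent] at hm
  rw [mem_support_iff]
  split_ifs at hm with h
  · exact hm
  · exact absurd rfl hm

theorem support_single_add [DecidableEq V] (v : V) (m : V →₀ ℕ) :
    (Finsupp.single v 1 + m).support = insert v m.support := by
  ext w
  simp only [Finsupp.mem_support_iff, Finsupp.add_apply, Finsupp.single_apply, Finset.mem_insert]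
  split_ifs with h
  · simp [h]
  · simp [Ne.symm h]

theorem X_mul_mem_supportIdeal_iff [DecidableEq V] (hU : Monotone U) {v : V}
    {p : MvPolynomial V K} :
    X v * p ∈ supportIdeal K U ↔ p ∈ supportIdeal K fun A => U (insert v A) := by
  rw [mem_supportIdeal_iff hU, mem_supportIdeal_iff fun A B h => hU (Finset.insert_subset_insert v h),
    support_X_mul]
  simp [support_single_add]

theorem mem_supportIdeal_iff_exists [DecidableEq V] (hU : Monotone U) (v : V)
    {p : MvPolynomial V K} :
    p ∈ supportIdeal K U ↔ ∃ f ∈ supportIdeal K (fun A => U (insert v A)),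
      ∃ l ∈ supportIdeal K (fun A => U (A.erase v)), p = X v * f + l := by
  have hU₂ : Monotone fun A : Finset V => U (A.erase v) :=
    fun A B h => hU (Finset.erase_subset_erase v h)
  constructor
  · intro hp
    have h := divMonomial_add_modMonomial_single p v
    have hl : p.modMonomial (Finsupp.single v 1) ∈ supportIdeal K (fun A => U (A.erase v)) := by
      rw [mem_supportIdeal_iff hU₂]
      intro m hm
      rw [mem_support_iff] at hm
      by_cases hv : Finsupp.single v 1 ≤ m
      · exact absurd (coeff_modMonomial_of_le _ hv) hm
      · rw [coeff_modMonomial_of_not_le _ hv] at hm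
        have hv' : v ∉ m.support := by
          simpa [Nat.one_le_iff_ne_zero] using hv
        rw [Finset.erase_eq_of_notMem hv']
        exact (mem_supportIdeal_iff hU).1 hp m (mem_support_iff.2 hm)
    refine ⟨_, ?_, _, hl, h.symm⟩
    rw [← X_mul_mem_supportIdeal_iff hU, eq_sub_of_add_eq h]
    refine Ideal.sub_mem _ hp ?_
    rw [mem_supportIdeal_iff hU]
    rw [mem_supportIdeal_iff hU₂] at hl
    exact fun m hm => hU (Finset.erase_subset v _) (hl m hm)
  · rintro ⟨f, hf, l, hl, rfl⟩
    refine Ideal.add_mem _ ((X_mul_mem_supportIdeal_iff hU).2 hf) ?_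
    rw [mem_supportIdeal_iff hU]
    rw [mem_supportIdeal_iff hU₂] at hl
    exact fun m hm => hU (Finset.erase_subset v _) (hl m hm)

/-- A decision tree for the squarefree monomials of an ideal bounds the degrees of its
syzygies. -/
theorem Decision.syzygyBound [DecidableEq V] {D : ℕ} (h : Decision U D) (hU : Monotone U) (n : ℕ) :
    SyzygyBound n (fun _ => 0) (idealModule (supportIdeal K U)) D := by
  induction h with
  | @never U D h =>
    convert syzygyBound_bot n (fun _ : Fin 1 => 0) (D : ℤ)
    rw [eq_bot_iff]
    intro z hz
    rw [mem_idealModule, mem_supportIdeal_iff hU] at hz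
    have : (z 0).support = ∅ := Finset.eq_empty_of_forall_notMem fun m hm => h _ (hz m hm)
    rw [Submodule.mem_bot]
    ext1 a
    rw [Subsingleton.elim a 0]
    exact support_eq_empty.1 this
  | @always U D h =>
    convert syzygyBound_top n (s := fun _ : Fin 1 => 0) (r := (D : ℤ)) (fun _ => Int.natCast_nonneg D)
    rw [eq_top_iff]
    intro z _
    rw [mem_idealModule, mem_supportIdeal_iff hU]
    exact fun m _ => h _
  | @query U D v h₁ h₂ ih₁ ih₂ =>
    have hU₁ : Monotone fun A : Finset V => U (insert v A) :=
      fun A B h => hU (Finset.insert_subset_insert v h)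
    have hU₂ : Monotone fun A : Finset V => U (A.erase v) :=
      fun A B h => hU (Finset.erase_subset_erase v h)
    have hx : intComponent 1 (X v : MvPolynomial V K) = X v := by
      rw [← mem_homogeneousPart_iff, homogeneousPart, if_pos zero_le_one]
      exact isHomogeneous_X K v
    push_cast
    refine SyzygyBound.splitting hx ?_ ?_ ?_ (ih₁ hU₁) (by exact_mod_cast ih₂ hU₂)
    · intro z
      rw [mem_idealModule, mem_supportIdeal_iff_exists hU v]
      constructor
      · rintro ⟨f, hf, l, hl, hz⟩
        refine ⟨fun _ => f, hf, fun _ => l, hl, ?_⟩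
        ext1 a
        rw [Subsingleton.elim a 0]
        exact hz
      · rintro ⟨f, hf, l, hl, rfl⟩
        exact ⟨f 0, hf, l 0, hl, rfl⟩
    · intro z hz
      rw [mem_idealModule, mem_supportIdeal_iff hU₂] at hz
      rw [mem_idealModule, mem_supportIdeal_iff hU₁]
      exact fun m hm => hU ((Finset.erase_subset v _).trans (Finset.subset_insert v _)) (hz m hm)
    · intro z _ hz
      rw [mem_idealModule, Pi.smul_apply, smul_eq_mul, X_mul_mem_supportIdeal_iff hU₂] at hz
      rw [mem_idealModule]
      simpa using hz

theorem mem_minimalGenerators_supportIdeal_iff (hU : Monotone U) {m : V →₀ ℕ} :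
    m ∈ minimalGenerators (supportIdeal K U) ↔ ∃ A, Minimal U A ∧ m = finsetExponent A := by
  change Minimal (fun e => monomial e (1 : K) ∈ supportIdeal K U) m ↔ _
  simp only [monomial_mem_supportIdeal_iff hU]
  constructor
  · intro hm
    have hle : finsetExponent m.support ≤ m := finsetExponent_le_iff.2 subset_rfl
    refine ⟨m.support, ⟨hm.prop, fun B hB hBm => ?_⟩, le_antisymm ?_ hle⟩
    · have h := hm.le_of_le (y := finsetExponent B) (by rwa [support_finsetExponent])
        (finsetExponent_le_iff.2 hBm)
      have h2 := Finsupp.support_mono h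
      rwa [support_finsetExponent] at h2
    · refine hm.le_of_le ?_ hle
      rw [support_finsetExponent]
      exact hm.prop
  · rintro ⟨A, hA, rfl⟩
    refine ⟨by simpa only [support_finsetExponent] using hA.prop, fun e he hle => ?_⟩
    rw [finsetExponent_le_iff]
    refine hA.le_of_le he ?_
    have h2 := Finsupp.support_mono hle
    rwa [support_finsetExponent] at h2

theorem hasDegree_and_hasRegularity_supportIdeal [DecidableEq V] [Finite V] {D : ℕ}
    (hU : Monotone U) (h : Decision U D) (hD : 1 ≤ D) (hA : ∃ A, Minimal U A ∧ A.card = D) :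
    HasDegree (supportIdeal K U) D ∧ HasRegularity (supportIdeal K U) ((D : ℤ) - 1) := by
  obtain ⟨A, hA, hAD⟩ := hA
  have hm : finsetExponent A ∈ minimalGenerators (supportIdeal K U) :=
    (mem_minimalGenerators_supportIdeal_iff hU).2 ⟨A, hA, rfl⟩
  have hdeg : (finsetExponent A).degree = D := by rw [degree_finsetExponent, hAD]
  refine ⟨⟨⟨_, hm, hdeg⟩, ?_⟩, hasRegularity_of_syzygyBound hD
    (isGradedSubmodule_supportIdeal hU) ?_ ?_ (h.syzygyBound hU) ⟨_, hm, hdeg⟩⟩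
  · rintro _ ⟨m, hm, rfl⟩
    obtain ⟨B, hB, rfl⟩ := (mem_minimalGenerators_supportIdeal_iff hU).1 hm
    rw [degree_finsetExponent]
    exact h.card_le hB
  · intro p hp
    by_contra h0
    have h1 := (mem_supportIdeal_iff hU).1 hp 0 (mem_support_iff.2 h0)
    rw [Finsupp.support_zero] at h1
    have h2 : A ⊆ ∅ := hA.le_of_le h1 (Finset.empty_subset A)
    rw [Finset.subset_empty.1 h2, Finset.card_empty] at hAD
    omega
  · intro p hp m hm
    rw [monomial_mem_supportIdeal_iff hU]
    exact (mem_supportIdeal_iff hU).1 hp m hm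

/-- The squarefree part of the `k`-th power of a facet ideal is generated by the monomials
`x_A` such that `A` contains `k` pairwise disjoint facets. -/
theorem squarefreePower_facetIdeal {Δ : Set (Finset V)} (hΔ : ∀ F ∈ facets Δ, F.Nonempty) (k : ℕ) :
    squarefreePower (facetIdeal K Δ) k =
      supportIdeal K fun A => ∃ M, IsMatching Δ M ∧ M.card = k ∧ ∀ F ∈ M, F ⊆ A := by
  classical
  have hset : {p | p ∈ facetIdeal K Δ ^ k ∧ ∃ A : Finset V, p = sqfreeMonomial K A} =
      sqfreeMonomial K '' {A | sqfreeMonomial K A ∈ facetIdeal K Δ ^ k} := by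
    ext p
    constructor
    · rintro ⟨hp, A, rfl⟩
      exact ⟨A, hp, rfl⟩
    · rintro ⟨A, hA, rfl⟩
      exact ⟨hA, A, rfl⟩
  rw [squarefreePower, hset, supportIdeal]
  congr 2
  ext A
  simp only [Set.mem_ofPred_eq]
  have hpow : (sqfreeMonomial K '' facets Δ) ^ k = (fun e => monomial e (1 : K)) ''
      {e | ∃ F : Fin k → Finset V, (∀ i, F i ∈ facets Δ) ∧ e = ∑ i, finsetExponent (F i)} := by
    ext p
    rw [Set.mem_pow_iff_prod]
    constructor
    · rintro ⟨f, hf, rfl⟩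
      choose F hF hFf using hf
      refine ⟨_, ⟨F, hF, rfl⟩, ?_⟩
      simp only [monomial_sum_one, ← sqfreeMonomial_eq, hFf]
    · rintro ⟨_, ⟨F, hF, rfl⟩, rfl⟩
      refine ⟨fun i => sqfreeMonomial K (F i), fun i => ⟨_, hF i, rfl⟩, ?_⟩
      simp only [monomial_sum_one, ← sqfreeMonomial_eq]
  rw [facetIdeal, Ideal.span, Submodule.span_pow, hpow, ← Ideal.span, sqfreeMonomial_eq,
    mem_ideal_span_monomial_image, support_monomial, if_neg one_ne_zero]
  simp only [Finset.mem_singleton, forall_eq, Set.mem_ofPred_eq]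
  constructor
  · rintro ⟨_, ⟨F, hF, rfl⟩, hle⟩
    have hsub : ∀ i, F i ⊆ A := by
      intro i
      rw [← support_finsetExponent A, ← finsetExponent_le_iff]
      exact (Finset.single_le_sum (f := fun i => finsetExponent (F i)) (fun _ _ => zero_le)
        (Finset.mem_univ i)).trans hle
    have hdisj : ∀ i j, i ≠ j → Disjoint (F i) (F j) := by
      intro i j hij
      rw [Finset.disjoint_left]
      intro v hi hj
      have h1 := hle v
      rw [Finsupp.finsetSum_apply] at h1
      have h2 : ∑ l ∈ {i, j}, finsetExponent (F l) v ≤ ∑ l, finsetExponent (F l) v :=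
        Finset.sum_le_sum_of_subset (Finset.subset_univ _)
      rw [Finset.sum_pair hij] at h2
      simp only [finsetExponent_apply, hi, hj, hsub i hi, if_true] at h1 h2
      omega
    have hinj : Function.Injective F := by
      intro i j hij
      by_contra hne
      have h1 := hdisj i j hne
      rw [← hij, Finset.disjoint_self_iff_empty] at h1
      exact (hΔ _ (hF i)).ne_empty h1
    refine ⟨Finset.univ.image F, ⟨?_, ?_⟩, ?_, ?_⟩
    · simpa using hF
    · intro X hX Y hY hne
      simp only [Finset.coe_image, Finset.coe_univ, Set.image_univ, Set.mem_range] at hX hY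
      obtain ⟨i, rfl⟩ := hX
      obtain ⟨j, rfl⟩ := hY
      exact hdisj i j fun h => hne (by rw [h])
    · rw [Finset.card_image_of_injective _ hinj, Finset.card_univ, Fintype.card_fin]
    · simpa using hsub
  · rintro ⟨M, ⟨hM, hdisj⟩, rfl, hMA⟩
    refine ⟨_, ⟨fun i => (M.equivFin.symm i : Finset V), fun i => hM _ (M.equivFin.symm i).2, rfl⟩,
      ?_⟩
    rw [Equiv.sum_comp M.equivFin.symm (fun F : M => finsetExponent (F : Finset V)),
      Finset.sum_coe_sort M finsetExponent]
    intro v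
    rw [Finsupp.finsetSum_apply, finsetExponent_apply]
    by_cases hv : ∃ F ∈ M, v ∈ F
    · obtain ⟨F, hF, hvF⟩ := hv
      rw [if_pos (hMA F hF hvF), Finset.sum_eq_single_of_mem F hF, finsetExponent_apply,
        if_pos hvF]
      intro E hE hne
      rw [finsetExponent_apply, if_neg]
      exact fun hvE => Finset.disjoint_left.1 (hdisj hE hF hne) hvE hvF
    · rw [Finset.sum_eq_zero]
      · exact Nat.zero_le _
      · intro F hF
        rw [finsetExponent_apply, if_neg fun h => hv ⟨F, hF, h⟩]

end SupportIdeal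

/-! ### Caterpillars as lists of spine vertices with their leaves -/

section Spine

variable {V : Type*}

/-- The last spine vertex has a leaf. -/
def EndsWithLeaf : List (V × Finset V) → Prop
  | [] => True
  | [p] => p.2.Nonempty
  | _ :: q :: s => EndsWithLeaf (q :: s)

theorem EndsWithLeaf.tail {p : V × Finset V} {s : List (V × Finset V)}
    (h : EndsWithLeaf (p :: s)) : EndsWithLeaf s := by
  cases s with
  | nil => trivial
  | cons q s => exact h

variable [DecidableEq V]

/-- The hypergraph of a list of spine vertices, each with its set of leaves: its edges are the
pairs of a spine vertex and one of its leaves, and the triples of consecutive spine vertices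
whose middle vertex has no leaves. -/
def IsSpineFacet : List (V × Finset V) → Finset V → Prop
  | [], _ => False
  | p :: s, F => (∃ ℓ ∈ p.2, F = {p.1, ℓ}) ∨
      (∃ y q t, s = (y, ∅) :: q :: t ∧ F = {p.1, y, q.1}) ∨ IsSpineFacet s F

/-- All the vertices of a list of spine vertices with leaves. -/
def spineVertices : List (V × Finset V) → Finset V
  | [] => ∅
  | p :: s => insert p.1 (p.2 ∪ spineVertices s)

/-- All the leaves of a list of spine vertices with leaves. -/
def spineLeaves : List (V × Finset V) → Finset V
  | [] => ∅
  | p :: s => p.2 ∪ spineLeaves s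

/-- The vertices in a list of spine vertices with leaves are distinct. -/
def IsProperSpine : List (V × Finset V) → Prop
  | [] => True
  | p :: s => p.1 ∉ p.2 ∧ p.1 ∉ spineVertices s ∧ Disjoint p.2 (spineVertices s) ∧ IsProperSpine s

/-- The greedy matching inside `A`, scanning the spine from its start; a pair contributes `a` and
a triple contributes `b`. -/
def greedy (a b : ℕ) : List (V × Finset V) → Finset V → ℕ
  | [], _ => 0
  | [p], A => if p.1 ∈ A ∧ ∃ ℓ ∈ p.2, ℓ ∈ A then a else 0
  | [p, q], A =>
    if p.1 ∈ A ∧ ∃ ℓ ∈ p.2, ℓ ∈ A then a + greedy a b [q] A else greedy a b [q] A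
  | p :: q :: r :: s, A =>
    if p.1 ∈ A ∧ ∃ ℓ ∈ p.2, ℓ ∈ A then a + greedy a b (q :: r :: s) A
    else if p.1 ∈ A ∧ q.2 = ∅ ∧ q.1 ∈ A ∧ r.1 ∈ A then b + greedy a b s A
    else greedy a b (q :: r :: s) A

theorem spineLeaves_subset (l : List (V × Finset V)) : spineLeaves l ⊆ spineVertices l := by
  induction l with
  | nil => exact subset_rfl
  | cons p s ih =>
    exact (Finset.union_subset_union subset_rfl ih).trans (Finset.subset_insert _ _)

theorem IsSpineFacet.subset {l : List (V × Finset V)} {F : Finset V} (h : IsSpineFacet l F) :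
    F ⊆ spineVertices l := by
  induction l with
  | nil => exact h.elim
  | cons p s ih =>
    rcases h with ⟨ℓ, hℓ, rfl⟩ | ⟨y, q, t, rfl, rfl⟩ | h
    · intro v hv
      simp only [Finset.mem_insert, Finset.mem_singleton] at hv
      rcases hv with rfl | rfl <;> simp [spineVertices, hℓ]
    · intro v hv
      simp only [Finset.mem_insert, Finset.mem_singleton] at hv
      rcases hv with rfl | rfl | rfl <;> simp [spineVertices]
    · exact (ih h).trans (Finset.subset_union_right.trans (Finset.subset_insert _ _))

section Greedy

variable {a b : ℕ} {p q r : V × Finset V} {s : List (V × Finset V)} {A : Finset V}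

theorem greedy_cons_of_leaf (hp : p.1 ∈ A) (hl : ∃ ℓ ∈ p.2, ℓ ∈ A) :
    greedy a b (p :: s) A = a + greedy a b s A := by
  match s with
  | [] => simp [greedy, hp, hl]
  | [q] => simp [greedy, hp, hl]
  | q :: r :: s => simp [greedy, hp, hl]

theorem greedy_cons_of_notMem (hp : p.1 ∉ A) :
    greedy a b (p :: s) A = greedy a b s A := by
  match s with
  | [] => simp [greedy, hp]
  | [q] => simp [greedy, hp]
  | q :: r :: s => simp [greedy, hp]

theorem greedy_cons_of_triple (hp : p.1 ∈ A) (hl : ¬ ∃ ℓ ∈ p.2, ℓ ∈ A) (hq : q.2 = ∅)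
    (hqA : q.1 ∈ A) (hr : r.1 ∈ A) :
    greedy a b (p :: q :: r :: s) A = b + greedy a b s A := by
  rw [greedy, if_neg fun h => hl h.2, if_pos ⟨hp, hq, hqA, hr⟩]

theorem greedy_cons_of_skip (hl : ¬ ∃ ℓ ∈ p.2, ℓ ∈ A)
    (ht : ∀ q r t, s = q :: r :: t → q.2 = ∅ → q.1 ∈ A → r.1 ∉ A) :
    greedy a b (p :: s) A = greedy a b s A := by
  match s with
  | [] => simp [greedy, hl]
  | [q] => simp [greedy, hl]
  | q :: r :: s =>
    rw [greedy, if_neg fun h => hl h.2, if_neg]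
    rintro ⟨-, h1, h2, h3⟩
    exact ht q r s rfl h1 h2 h3

end Greedy

theorem greedy_congr {a b : ℕ} {A B : Finset V} : ∀ {l : List (V × Finset V)},
    (∀ v ∈ spineVertices l, v ∈ A ↔ v ∈ B) → greedy a b l A = greedy a b l B
  | [], _ => rfl
  | p :: s, h => by
    have hs : ∀ v ∈ spineVertices s, v ∈ A ↔ v ∈ B :=
      fun v hv => h v (by simp [spineVertices, hv])
    have ih := greedy_congr (a := a) (b := b) hs
    have hp : p.1 ∈ A ↔ p.1 ∈ B := h _ (by simp [spineVertices])
    have hl : (∃ ℓ ∈ p.2, ℓ ∈ A) ↔ ∃ ℓ ∈ p.2, ℓ ∈ B :=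
      exists_congr fun ℓ => and_congr_right fun hℓ => h ℓ (by simp [spineVertices, hℓ])
    match s with
    | [] => simp only [greedy, hp, hl]
    | [q] => simp only [greedy, hp, hl] at ih ⊢; rw [ih]
    | q :: r :: s =>
      have ih' : greedy a b s A = greedy a b s B :=
        greedy_congr fun v hv => hs v (by simp [spineVertices, hv])
      have hq : q.1 ∈ A ↔ q.1 ∈ B := hs _ (by simp [spineVertices])
      have hr : r.1 ∈ A ↔ r.1 ∈ B := hs _ (by simp [spineVertices])
      simp only [greedy.eq_4, hp, hl, hq, hr, ih, ih']

theorem greedy_insert {a b : ℕ} {A : Finset V} {l : List (V × Finset V)} {v : V}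
    (hv : v ∉ spineVertices l) : greedy a b l (insert v A) = greedy a b l A := by
  refine greedy_congr fun w hw => ?_
  rw [Finset.mem_insert, or_iff_right]
  rintro rfl
  exact hv hw

theorem greedy_erase {a b : ℕ} {A : Finset V} {l : List (V × Finset V)} {v : V}
    (hv : v ∉ spineVertices l) : greedy a b l (A.erase v) = greedy a b l A := by
  refine greedy_congr fun w hw => ?_
  rw [Finset.mem_erase, and_iff_right]
  rintro rfl
  exact hv hw

/-- The greedy matching. -/
theorem exists_greedy_matching {A : Finset V} : ∀ {l : List (V × Finset V)}, IsProperSpine l →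
    ∃ M : Finset (Finset V), (∀ F ∈ M, IsSpineFacet l F ∧ F ⊆ A) ∧
      (M : Set (Finset V)).PairwiseDisjoint id ∧ M.card = greedy 1 1 l A ∧
      ∑ F ∈ M, F.card = greedy 2 3 l A
  | [], _ => ⟨∅, by simp, by simp, rfl, rfl⟩
  | p :: s, hl => by
    obtain ⟨hp1, hp2, hp3, hs⟩ := hl
    have extend : ∀ (c : ℕ) (F : Finset V) (t : List (V × Finset V)), F.card = c → F.Nonempty → F ⊆ A →
        IsSpineFacet (p :: s) F → (∀ E, IsSpineFacet t E → IsSpineFacet s E) →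
        Disjoint F (spineVertices t) →
        (∃ M : Finset (Finset V), (∀ F ∈ M, IsSpineFacet t F ∧ F ⊆ A) ∧
          (M : Set (Finset V)).PairwiseDisjoint id ∧ M.card = greedy 1 1 t A ∧
          ∑ F ∈ M, F.card = greedy 2 3 t A) →
        ∃ M : Finset (Finset V), (∀ F ∈ M, IsSpineFacet (p :: s) F ∧ F ⊆ A) ∧
          (M : Set (Finset V)).PairwiseDisjoint id ∧ M.card = 1 + greedy 1 1 t A ∧
          ∑ F ∈ M, F.card = c + greedy 2 3 t A := by
      rintro c F t rfl hF0 hFA hF ht hdisj ⟨M, hM, hMd, hMc, hMs⟩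
      have hFM : ∀ E ∈ M, Disjoint F E := fun E hE => hdisj.mono_right (hM E hE).1.subset
      have hnot : F ∉ M := by
        intro h
        have := hFM F h
        rw [Finset.disjoint_self_iff_empty] at this
        exact hF0.ne_empty this
      refine ⟨insert F M, ?_, ?_, ?_, ?_⟩
      · intro E hE
        rcases Finset.mem_insert.1 hE with rfl | hE
        · exact ⟨hF, hFA⟩
        · exact ⟨Or.inr (Or.inr (ht E (hM E hE).1)), (hM E hE).2⟩
      · rw [Finset.coe_insert]
        exact hMd.insert fun E hE _ => hFM E hE
      · rw [Finset.card_insert_of_notMem hnot, hMc, add_comm]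
      · rw [Finset.sum_insert hnot, hMs]
    by_cases hleaf : p.1 ∈ A ∧ ∃ ℓ ∈ p.2, ℓ ∈ A
    · obtain ⟨hpA, ℓ, hℓ, hℓA⟩ := hleaf
      rw [greedy_cons_of_leaf hpA ⟨ℓ, hℓ, hℓA⟩, greedy_cons_of_leaf hpA ⟨ℓ, hℓ, hℓA⟩]
      have hne : p.1 ≠ ℓ := by rintro rfl; exact hp1 hℓ
      refine extend 2 {p.1, ℓ} s (Finset.card_pair hne) ⟨_, Finset.mem_insert_self _ _⟩ ?_ (Or.inl ⟨ℓ, hℓ, rfl⟩)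
        (fun _ h => h) ?_ (exists_greedy_matching hs)
      · simp [Finset.insert_subset_iff, hpA, hℓA]
      · rw [Finset.disjoint_insert_left, Finset.disjoint_singleton_left]
        exact ⟨hp2, Finset.disjoint_left.1 hp3 hℓ⟩
    by_cases htrip : ∃ q r t, s = q :: r :: t ∧ p.1 ∈ A ∧ q.2 = ∅ ∧ q.1 ∈ A ∧ r.1 ∈ A
    · obtain ⟨⟨y, L⟩, r, t, rfl, hpA, hq, hqA, hrA⟩ := htrip
      obtain rfl : L = ∅ := hq
      have hno : ¬ ∃ ℓ ∈ p.2, ℓ ∈ A := fun h => hleaf ⟨hpA, h⟩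
      rw [greedy_cons_of_triple hpA hno rfl hqA hrA, greedy_cons_of_triple hpA hno rfl hqA hrA]
      obtain ⟨-, hy, -, hr1, hr2, hr3, ht⟩ := hs
      simp only [spineVertices, Finset.mem_insert, Finset.mem_union, not_or] at hp2 hy
      have hcard : ({p.1, y, r.1} : Finset V).card = 3 := by
        rw [Finset.card_eq_three]
        exact ⟨p.1, y, r.1, hp2.1, hp2.2.2.1, hy.1, rfl⟩
      refine extend 3 {p.1, y, r.1} t hcard ⟨_, Finset.mem_insert_self _ _⟩ ?_
        (Or.inr (Or.inl ⟨y, r, t, rfl, rfl⟩)) (fun _ h => Or.inr (Or.inr (Or.inr (Or.inr h)))) ?_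
        (exists_greedy_matching ht)
      · simp only [Finset.insert_subset_iff, Finset.singleton_subset_iff]
        exact ⟨hpA, hqA, hrA⟩
      · simp only [Finset.disjoint_insert_left, Finset.disjoint_singleton_left]
        exact ⟨hp2.2.2.2.2, hy.2.2, hr2⟩
    · obtain ⟨M, hM, hMd, hMc, hMs⟩ := exists_greedy_matching (A := A) hs
      have hskip : ∀ a b, greedy a b (p :: s) A = greedy a b s A := by
        intro a b
        by_cases hpA : p.1 ∈ A
        · refine greedy_cons_of_skip (fun h => hleaf ⟨hpA, h⟩) fun q r t ht hq hqA hrA => ?_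
          exact htrip ⟨q, r, t, ht, hpA, hq, hqA, hrA⟩
        · exact greedy_cons_of_notMem hpA
      exact ⟨M, fun F hF => ⟨Or.inr (Or.inr (hM F hF).1), (hM F hF).2⟩, hMd,
        by rw [hskip, hMc], by rw [hskip, hMs]⟩

theorem card_le_one_add_card_filter {M : Finset (Finset V)}
    (hM : (M : Set (Finset V)).PairwiseDisjoint id) (v : V) :
    M.card ≤ 1 + (M.filter fun F => v ∉ F).card := by
  rw [← Finset.card_filter_add_card_filter_not (s := M) (fun F => v ∈ F)]
  refine Nat.add_le_add_right (Finset.card_le_one.2 fun F hF E hE => ?_) _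
  rw [Finset.mem_filter] at hF hE
  by_contra hne
  exact Finset.disjoint_left.1 (hM hF.1 hE.1 hne) hF.2 hE.2

/-- The greedy matching is a maximum matching. -/
theorem card_le_greedy {A : Finset V} : ∀ {l : List (V × Finset V)} {M : Finset (Finset V)},
    (∀ F ∈ M, IsSpineFacet l F ∧ F ⊆ A) → (M : Set (Finset V)).PairwiseDisjoint id →
      M.card ≤ greedy 1 1 l A
  | [], M, hM, _ => by
    rw [Finset.eq_empty_of_forall_notMem fun F hF => (hM F hF).1]
    exact Nat.zero_le _
  | p :: s, M, hM, hd => by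
    have step : ∀ (v : V) (t : List (V × Finset V)),
        (∀ F ∈ M, v ∉ F → IsSpineFacet t F) →
        (∀ {M : Finset (Finset V)}, (∀ F ∈ M, IsSpineFacet t F ∧ F ⊆ A) →
          (M : Set (Finset V)).PairwiseDisjoint id → M.card ≤ greedy 1 1 t A) →
        M.card ≤ 1 + greedy 1 1 t A := by
      intro v t h ih
      refine (card_le_one_add_card_filter hd v).trans (Nat.add_le_add_left (ih ?_ ?_) 1)
      · intro F hF
        rw [Finset.mem_filter] at hF
        exact ⟨h F hF.1 hF.2, (hM F hF.1).2⟩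
      · exact hd.subset (Finset.coe_subset.2 (Finset.filter_subset _ _))
    by_cases hpA : p.1 ∈ A
    · by_cases hleaf : ∃ ℓ ∈ p.2, ℓ ∈ A
      · rw [greedy_cons_of_leaf hpA hleaf]
        refine step p.1 s ?_ card_le_greedy
        rintro F hF hv
        rcases (hM F hF).1 with ⟨ℓ, -, rfl⟩ | ⟨y, q, t, -, rfl⟩ | h
        · simp at hv
        · simp at hv
        · exact h
      · by_cases htrip : ∃ q r t, s = q :: r :: t ∧ q.2 = ∅ ∧ q.1 ∈ A ∧ r.1 ∈ A
        · obtain ⟨⟨y, L⟩, r, t, rfl, hq, hqA, hrA⟩ := htrip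
          obtain rfl : L = ∅ := hq
          rw [greedy_cons_of_triple hpA hleaf rfl hqA hrA]
          refine step r.1 t ?_ card_le_greedy
          rintro F hF hv
          have hFA := (hM F hF).2
          rcases (hM F hF).1 with ⟨ℓ, hℓ, rfl⟩ | ⟨y', q, t', heq, rfl⟩ | h
          · exact absurd ⟨ℓ, hℓ, hFA (by simp)⟩ hleaf
          · simp only [List.cons.injEq] at heq
            obtain ⟨-, rfl, -⟩ := heq
            simp at hv
          · rcases h with ⟨ℓ, hℓ, rfl⟩ | ⟨y', q, t', heq, rfl⟩ | h
            · simp at hℓ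
            · simp only [List.cons.injEq] at heq
              obtain ⟨rfl, -⟩ := heq
              simp at hv
            · rcases h with ⟨ℓ, hℓ, rfl⟩ | ⟨y', q, t', heq, rfl⟩ | h
              · simp at hv
              · simp at hv
              · exact h
        · rw [greedy_cons_of_skip hleaf fun q r t ht hq hqA hrA =>
            htrip ⟨q, r, t, ht, hq, hqA, hrA⟩]
          refine card_le_greedy (fun F hF => ⟨?_, (hM F hF).2⟩) hd
          have hFA := (hM F hF).2
          rcases (hM F hF).1 with ⟨ℓ, hℓ, rfl⟩ | ⟨y, q, t, rfl, rfl⟩ | h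
          · exact absurd ⟨ℓ, hℓ, hFA (by simp)⟩ hleaf
          · exact absurd ⟨_, _, _, rfl, rfl, hFA (by simp), hFA (by simp)⟩ htrip
          · exact h
    · rw [greedy_cons_of_notMem hpA]
      refine card_le_greedy (fun F hF => ⟨?_, (hM F hF).2⟩) hd
      have hFA := (hM F hF).2
      rcases (hM F hF).1 with ⟨ℓ, hℓ, rfl⟩ | ⟨y, q, t, rfl, rfl⟩ | h
      · exact absurd (hFA (by simp)) hpA
      · exact absurd (hFA (by simp)) hpA
      · exact h

end Spine

section SpineDecision

variable {V : Type*} [DecidableEq V]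

section Increments

variable [Fintype V]

/-- The matching number of the hypergraph of a spine. -/
def spineNumber (l : List (V × Finset V)) : ℕ := greedy 1 1 l Finset.univ

/-- The number of vertices covered by the greedy matching of the hypergraph of a spine. -/
def spineDegree (l : List (V × Finset V)) : ℕ := greedy 2 3 l Finset.univ

theorem greedy_univ_of_leaf {a b : ℕ} {p : V × Finset V} (hp : p.2.Nonempty)
    (s : List (V × Finset V)) :
    greedy a b (p :: s) Finset.univ = a + greedy a b s Finset.univ :=
  greedy_cons_of_leaf (Finset.mem_univ _) (hp.imp fun _ h => ⟨h, Finset.mem_univ _⟩)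

theorem greedy_univ_of_triple {a b : ℕ} (x y : V) (r : V × Finset V) (s : List (V × Finset V)) :
    greedy a b ((x, ∅) :: (y, ∅) :: r :: s) Finset.univ = b + greedy a b s Finset.univ :=
  greedy_cons_of_triple (Finset.mem_univ _) (by simp) rfl (Finset.mem_univ _) (Finset.mem_univ _)

theorem greedy_univ_of_before_leaf {a b : ℕ} (x : V) {q : V × Finset V} (hq : q.2.Nonempty)
    (s : List (V × Finset V)) :
    greedy a b ((x, ∅) :: q :: s) Finset.univ = greedy a b (q :: s) Finset.univ :=
  greedy_cons_of_skip (by simp) fun q' r t h hq' => by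
    obtain ⟨rfl, -⟩ := List.cons.inj h
    exact absurd hq' hq.ne_empty

theorem spine_increment : ∀ {p : V × Finset V} {s : List (V × Finset V)}, EndsWithLeaf (p :: s) →
    (spineNumber (p :: s) = spineNumber s ∧ spineDegree s ≤ spineDegree (p :: s) ∧
      spineDegree (p :: s) ≤ spineDegree s + 1) ∨
    (spineNumber (p :: s) = spineNumber s + 1 ∧ spineDegree (p :: s) = spineDegree s + 2)
  | (x, L), s, h => by
    unfold spineNumber spineDegree
    rcases L.eq_empty_or_nonempty with rfl | hL
    swap
    · rw [greedy_univ_of_leaf hL, greedy_univ_of_leaf hL]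
      omega
    match s with
    | [] => exact absurd h Finset.not_nonempty_empty
    | (y, M) :: s =>
      rcases M.eq_empty_or_nonempty with rfl | hM
      swap
      · rw [greedy_univ_of_before_leaf x hM, greedy_univ_of_before_leaf x hM]
        omega
      match s with
      | [] => exact absurd h Finset.not_nonempty_empty
      | (z, N) :: s =>
        rw [greedy_univ_of_triple, greedy_univ_of_triple]
        have h1 := spine_increment h.tail
        have h2 := spine_increment h.tail.tail
        unfold spineNumber spineDegree at h1 h2
        rcases N.eq_empty_or_nonempty with rfl | hN
        · match s with
          | [] => exact absurd h Finset.not_nonempty_empty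
          | q :: t =>
            have h3 := spine_increment h.tail.tail.tail
            unfold spineNumber spineDegree at h3
            rw [greedy_univ_of_triple, greedy_univ_of_triple] at h1 ⊢
            omega
        · rw [greedy_univ_of_before_leaf y hN, greedy_univ_of_before_leaf y hN] at h1 ⊢
          rw [greedy_univ_of_leaf hN, greedy_univ_of_leaf hN] at h1 ⊢
          omega

theorem spine_double_increment {p q : V × Finset V} {s : List (V × Finset V)}
    (h : EndsWithLeaf (p :: q :: s)) (hs : spineNumber (p :: q :: s) = spineNumber s) :
    spineDegree (p :: q :: s) = spineDegree s + 1 := by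
  obtain ⟨x, L⟩ := p
  obtain ⟨y, M⟩ := q
  have h1 := spine_increment h
  have h2 := spine_increment h.tail
  rcases L.eq_empty_or_nonempty with rfl | hL
  swap
  · have h3 : spineNumber ((x, L) :: (y, M) :: s) = _ := greedy_univ_of_leaf hL _
    change _ = 1 + spineNumber _ at h3
    omega
  rcases M.eq_empty_or_nonempty with rfl | hM
  swap
  · have h3 : spineNumber ((y, M) :: s) = _ := greedy_univ_of_leaf hM _
    change _ = 1 + spineNumber _ at h3
    omega
  match s with
  | [] => exact absurd h Finset.not_nonempty_empty
  | r :: t =>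
    have h3 := spine_increment h.tail.tail
    have h4 : spineNumber ((x, ∅) :: (y, ∅) :: r :: t) = 1 + spineNumber t :=
      greedy_univ_of_triple _ _ _ _
    have h5 : spineDegree ((x, ∅) :: (y, ∅) :: r :: t) = 3 + spineDegree t :=
      greedy_univ_of_triple _ _ _ _
    omega

theorem two_le_spineDegree : ∀ {l : List (V × Finset V)}, l ≠ [] → EndsWithLeaf l →
    2 ≤ spineDegree l
  | [], h, _ => absurd rfl h
  | [p], _, h => by
    have h1 : spineDegree [p] = _ := greedy_univ_of_leaf h _
    omega
  | p :: q :: s, _, h => by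
    have h1 := spine_increment h
    have h2 := two_le_spineDegree (List.cons_ne_nil q s) h.tail
    omega

end Increments

theorem Decision.congr {U U' : Finset V → Prop} {D : ℕ} (h : Decision U D)
    (hU : ∀ A, U' A ↔ U A) : Decision U' D := by
  rwa [show U' = U from funext fun A => propext (hU A)]

/-- A query of an element that is irrelevant for the rest of the decision. -/
theorem Decision.query_of_irrelevant {U U₁ U₂ : Finset V → Prop} {D : ℕ} {v : V}
    (h₁ : Decision U₁ D) (h₂ : Decision U₂ (D + 1))
    (hv₁ : ∀ A, U₁ (insert v A) ↔ U₁ A) (hv₂ : ∀ A, U₂ (A.erase v) ↔ U₂ A)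
    (hU₁ : ∀ A, v ∈ A → (U A ↔ U₁ A)) (hU₂ : ∀ A, v ∉ A → (U A ↔ U₂ A)) :
    Decision U (D + 1) :=
  .query v (h₁.congr fun A => (hU₁ _ (Finset.mem_insert_self v A)).trans (hv₁ A))
    (h₂.congr fun A => (hU₂ _ (Finset.notMem_erase v A)).trans (hv₂ A))

/-- Querying the elements of a set until one of them is found. -/
theorem Decision.query_exists {U₁ U₂ : Finset V → Prop} {D : ℕ} (h₁ : Decision U₁ D)
    (h₂ : Decision U₂ (D + 1)) {L : Finset V}
    (hL₁ : ∀ v ∈ L, ∀ A, U₁ (insert v A) ↔ U₁ A) (hL₂ : ∀ v ∈ L, ∀ A, U₂ (A.erase v) ↔ U₂ A)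
    {U : Finset V → Prop} (hU₁ : ∀ A, (∃ v ∈ L, v ∈ A) → (U A ↔ U₁ A))
    (hU₂ : ∀ A, (¬ ∃ v ∈ L, v ∈ A) → (U A ↔ U₂ A)) :
    Decision U (D + 1) := by
  induction L using Finset.induction_on generalizing U with
  | empty => exact h₂.congr fun A => hU₂ A (by simp)
  | insert w L hw ih =>
    have hLd := fun v hv => hL₁ v (Finset.mem_insert_of_mem hv)
    have hLe := fun v hv => hL₂ v (Finset.mem_insert_of_mem hv)
    refine .query w (h₁.congr fun A => ?_) (ih hLd hLe (fun A hA => ?_) fun A hA => ?_)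
    · exact (hU₁ _ ⟨w, Finset.mem_insert_self _ _, Finset.mem_insert_self _ _⟩).trans
        (hL₁ w (Finset.mem_insert_self _ _) A)
    · obtain ⟨v, hv, hvA⟩ := hA
      have hne : v ≠ w := by rintro rfl; exact hw hv
      refine (hU₁ _ ⟨v, Finset.mem_insert_of_mem hv, Finset.mem_erase.2 ⟨hne, hvA⟩⟩).trans ?_
      rw [← hL₁ w (Finset.mem_insert_self _ _), ← hL₁ w (Finset.mem_insert_self _ _) A]
      rw [show insert w (A.erase w) = insert w A by
        ext u; by_cases h : u = w <;> simp [h]]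
    · refine (hU₂ _ ?_).trans (hL₂ w (Finset.mem_insert_self _ _) A)
      rintro ⟨v, hv, hvA⟩
      rw [Finset.mem_erase] at hvA
      exact hA ⟨v, (Finset.mem_insert.1 hv).resolve_left hvA.1, hvA.2⟩

/-- The first two spine vertices can be completed to a triple and `A` contains `k` disjoint
edges beyond them. -/
def StartsWithTriple (s : List (V × Finset V)) (k : ℕ) (A : Finset V) : Prop :=
  ∃ q r t, s = q :: r :: t ∧ q.2 = ∅ ∧ q.1 ∈ A ∧ r.1 ∈ A ∧ k ≤ greedy 1 1 t A

theorem startsWithTriple_congr {s : List (V × Finset V)} {k : ℕ} {A B : Finset V}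
    (h : ∀ v ∈ spineVertices s, v ∈ A ↔ v ∈ B) :
    StartsWithTriple s k A ↔ StartsWithTriple s k B := by
  refine exists_congr fun q => exists_congr fun r => exists_congr fun t =>
    and_congr_right fun hs => and_congr_right fun _ => ?_
  subst hs
  rw [h q.1 (by simp [spineVertices]), h r.1 (by simp [spineVertices]),
    greedy_congr fun v hv => h v (by simp [spineVertices, hv])]

variable [Fintype V]

theorem greedy_le_spineNumber {l : List (V × Finset V)} (hl : IsProperSpine l) (A : Finset V) :
    greedy 1 1 l A ≤ spineNumber l := by
  obtain ⟨M, hM, hd, hc, -⟩ := exists_greedy_matching (A := A) hl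
  rw [← hc]
  exact card_le_greedy (fun F hF => ⟨(hM F hF).1, Finset.subset_univ F⟩) hd

/-- Deciding whether a suffix of the spine carries a matching of the size `k`, where `k` is at
least the matching number of that suffix. -/
theorem decision_of_le {l : List (V × Finset V)} (hl : IsProperSpine l) {k D : ℕ}
    (hk : spineNumber l ≤ k)
    (h : spineNumber l = k → Decision (fun A => spineNumber l ≤ greedy 1 1 l A) D) :
    Decision (fun A => k ≤ greedy 1 1 l A) D := by
  rcases hk.eq_or_lt with rfl | hk
  · exact h rfl
  · refine .never fun A hA => ?_
    have := greedy_le_spineNumber hl A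
    omega

theorem decision_startsWithTriple {s : List (V × Finset V)} (hs : IsProperSpine s)
    (he : EndsWithLeaf s)
    (ih : ∀ {t : List (V × Finset V)}, IsProperSpine t → t.length < s.length → EndsWithLeaf t →
      Decision (fun A => spineNumber t ≤ greedy 1 1 t A) (spineDegree t)) :
    Decision (StartsWithTriple s (spineNumber s)) (spineDegree s + 1) := by
  by_cases h : ∃ q r t, s = q :: r :: t ∧ q.2 = ∅ ∧ spineNumber s = spineNumber t
  · obtain ⟨⟨y, L⟩, ⟨z, M⟩, t, rfl, hq, hν⟩ := h
    obtain rfl : L = ∅ := hq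
    have hD := spine_double_increment he hν
    obtain ⟨-, hy, -, -, hz, -, ht⟩ := hs
    simp only [spineVertices, Finset.mem_insert, Finset.mem_union, not_or] at hy
    have h1 := ih ht (by simp) he.tail.tail
    have h2 : Decision (fun A => z ∈ A ∧ spineNumber t ≤ greedy 1 1 t A) (spineDegree t + 1) := by
      refine h1.query_of_irrelevant (v := z) (.never (U := fun _ => False) fun _ => id)
        (fun A => by rw [greedy_insert hz]) (fun _ => Iff.rfl) ?_ ?_
      · exact fun A hA => and_iff_right hA
      · exact fun A hA => iff_of_false (fun h => hA h.1) id
    rw [hD, hν]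
    refine h2.query_of_irrelevant (v := y) (.never (U := fun _ => False) fun _ => id)
      (fun A => ?_) (fun _ => Iff.rfl) ?_ ?_
    · rw [greedy_insert hy.2.2, Finset.mem_insert, or_iff_right (Ne.symm hy.1)]
    · intro A hA
      constructor
      · rintro ⟨q, r, t', heq, -, -, h3, h4⟩
        simp only [List.cons.injEq] at heq
        obtain ⟨rfl, rfl, rfl⟩ := heq
        exact ⟨h3, h4⟩
      · rintro ⟨h3, h4⟩
        exact ⟨_, _, _, rfl, rfl, hA, h3, h4⟩
    · intro A hA
      refine iff_of_false ?_ id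
      rintro ⟨q, r, t', heq, -, h3, -, -⟩
      simp only [List.cons.injEq] at heq
      obtain ⟨rfl, -⟩ := heq
      exact hA h3
  · refine .never ?_
    rintro A ⟨q, r, t, rfl, hq, -, -, hk⟩
    refine h ⟨q, r, t, rfl, hq, le_antisymm (hk.trans (greedy_le_spineNumber hs.2.2.2.2.2.2 A)) ?_⟩
    have h1 := spine_increment he
    have h2 := spine_increment he.tail
    omega

theorem decision_spine_of_shorter : ∀ {l : List (V × Finset V)}, IsProperSpine l →
    EndsWithLeaf l →
    (∀ {t : List (V × Finset V)}, IsProperSpine t → t.length < l.length → EndsWithLeaf t →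
      Decision (fun A => spineNumber t ≤ greedy 1 1 t A) (spineDegree t)) →
    Decision (fun A => spineNumber l ≤ greedy 1 1 l A) (spineDegree l)
  | [], _, _, _ => .always fun _ => Nat.zero_le _
  | (x, L) :: s, hl, he, ih => by
    have hl' := hl
    obtain ⟨hx1, hx2, hx3, hs⟩ := hl
    have ihs := ih hs (by simp) he.tail
    rcases L.eq_empty_or_nonempty with rfl | hL
    · match s with
      | [] => exact absurd he Finset.not_nonempty_empty
      | (y, M) :: s =>
        rcases M.eq_empty_or_nonempty with rfl | hM
        swap
        · have h1 : ∀ A, greedy 1 1 ((x, ∅) :: (y, M) :: s) A = greedy 1 1 ((y, M) :: s) A :=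
            fun A => greedy_cons_of_skip (by simp) fun q' r t h hq' => by
              obtain ⟨rfl, -⟩ := List.cons.inj h
              exact absurd hq' hM.ne_empty
          have h2 : spineDegree ((x, ∅) :: (y, M) :: s) = spineDegree ((y, M) :: s) :=
            greedy_univ_of_before_leaf x hM s
          rw [h2]
          exact ihs.congr fun A => by rw [spineNumber, h1, h1]; rfl
        match s with
        | [] => exact absurd he Finset.not_nonempty_empty
        | (z, N) :: s =>
          have hν : spineNumber ((x, ∅) :: (y, ∅) :: (z, N) :: s) = 1 + spineNumber s :=
            greedy_univ_of_triple _ _ _ _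
          have hD : spineDegree ((x, ∅) :: (y, ∅) :: (z, N) :: s) = spineDegree s + 1 + 1 + 1 := by
            have : spineDegree ((x, ∅) :: (y, ∅) :: (z, N) :: s) = 3 + spineDegree s :=
              greedy_univ_of_triple _ _ _ _
            omega
          have hd1 := spine_increment he
          have hd2 := spine_increment he.tail.tail
          have hd3 := spine_increment he.tail
          obtain ⟨-, hy2, -, hzs⟩ := hs
          have hzs' := hzs
          obtain ⟨-, hz2, -, hs'⟩ := hzs
          have hxs : x ∉ spineVertices s ∧ x ∉ spineVertices ((z, N) :: s) := by
            simp only [spineVertices, Finset.mem_insert, Finset.mem_union, not_or] at hx2 ⊢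
            tauto
          have hys : y ∉ spineVertices s := by
            simp only [spineVertices, Finset.mem_insert, Finset.mem_union, not_or] at hy2 ⊢
            tauto
          have hxy : x ≠ y ∧ x ≠ z := by
            simp only [spineVertices, Finset.mem_insert, Finset.mem_union, not_or] at hx2
            tauto
          have hyz : y ≠ z := by
            simp only [spineVertices, Finset.mem_insert, Finset.mem_union, not_or] at hy2
            tauto
          have tail_eq : ∀ A : Finset V, (y ∈ A → z ∉ A) →
              greedy 1 1 ((y, ∅) :: (z, N) :: s) A = greedy 1 1 ((z, N) :: s) A := by
            intro A hA
            by_cases hyA : y ∈ A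
            · have hz := hA hyA
              refine greedy_cons_of_skip (by simp) fun q' r t h hq' hq'A => ?_
              obtain ⟨rfl, -⟩ := List.cons.inj h
              exact absurd hq'A hz
            · exact greedy_cons_of_notMem hyA
          have head_eq : ∀ A : Finset V, ¬ (x ∈ A ∧ y ∈ A ∧ z ∈ A) →
              greedy 1 1 ((x, ∅) :: (y, ∅) :: (z, N) :: s) A =
                greedy 1 1 ((y, ∅) :: (z, N) :: s) A := by
            intro A hA
            by_cases hxA : x ∈ A
            · refine greedy_cons_of_skip (by simp) fun q' r t h hq' hq'A hrA => ?_
              simp only [List.cons.injEq] at h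
              obtain ⟨rfl, rfl, -⟩ := h
              exact hA ⟨hxA, hq'A, hrA⟩
            · exact greedy_cons_of_notMem hxA
          rw [hν, hD]
          have hz : Decision (fun A => z ∈ A ∧ spineNumber s ≤ greedy 1 1 s A)
              (spineDegree s + 1) := by
            refine (ih hs' (by simp; omega) he.tail.tail.tail).query_of_irrelevant (v := z)
              (.never (U := fun _ => False) fun _ => id)
              (fun A => by rw [greedy_insert hz2]) (fun _ => Iff.rfl) ?_ ?_
            · exact fun A hA => and_iff_right hA
            · exact fun A hA => iff_of_false (fun h => hA h.1) id
          have hy : Decision (fun A => if y ∈ A then z ∈ A ∧ spineNumber s ≤ greedy 1 1 s A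
              else 1 + spineNumber s ≤ greedy 1 1 ((z, N) :: s) A) (spineDegree s + 1 + 1) := by
            refine hz.query_of_irrelevant (v := y) (decision_of_le (k := 1 + spineNumber s) hzs' (by omega) fun _ =>
              (ih hzs' (by simp) he.tail.tail).mono (by omega)) ?_ ?_ ?_ ?_
            · intro A
              rw [greedy_insert hys, Finset.mem_insert, or_iff_right hyz.symm]
            · intro A
              rw [greedy_erase hy2]
            · intro A hA
              rw [if_pos hA]
            · intro A hA
              rw [if_neg hA]
          refine hy.query_of_irrelevant (v := x) (decision_of_le (k := 1 + spineNumber s) hl'.2.2.2 (by omega) fun _ =>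
            ihs.mono (by omega)) ?_ ?_ ?_ ?_
          · intro A
            simp only [greedy_insert hxs.1, greedy_insert hxs.2, Finset.mem_insert, hxy.1.symm,
              hxy.2.symm, false_or]
          · intro A
            rw [greedy_erase hx2]
          · intro A hA
            split_ifs with hyA
            · by_cases hzA : z ∈ A
              · rw [and_iff_right hzA, greedy_cons_of_triple hA (by simp) rfl hyA hzA]
                omega
              · rw [head_eq A fun h => hzA h.2.2, tail_eq A fun _ => hzA, greedy_cons_of_notMem hzA]
                have := greedy_le_spineNumber hs' A
                exact iff_of_false (by omega) fun h => hzA h.1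
            · rw [head_eq A fun h => hyA h.2.1, tail_eq A fun h => absurd h hyA]
          · intro A hA
            rw [head_eq A fun h => hA h.1]
    · have hν : spineNumber ((x, L) :: s) = 1 + spineNumber s := greedy_univ_of_leaf hL _
      have hD : spineDegree ((x, L) :: s) = spineDegree s + 1 + 1 := by
        have : spineDegree ((x, L) :: s) = 2 + spineDegree s := greedy_univ_of_leaf hL _
        omega
      have hx : ∀ ℓ ∈ L, ℓ ∉ spineVertices s := fun ℓ hℓ => Finset.disjoint_left.1 hx3 hℓ
      have hblock := decision_startsWithTriple hs he.tail fun ht hlt => ih ht (hlt.trans (by simp))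
      rw [hν, hD]
      have hleaf : Decision (fun A => ((∃ ℓ ∈ L, ℓ ∈ A) ∧ spineNumber s ≤ greedy 1 1 s A) ∨
          ((¬ ∃ ℓ ∈ L, ℓ ∈ A) ∧ StartsWithTriple s (spineNumber s) A)) (spineDegree s + 1) := by
        refine ihs.query_exists (L := L) hblock (fun ℓ hℓ A => by rw [greedy_insert (hx ℓ hℓ)])
          (fun ℓ hℓ A => ?_) ?_ ?_
        · refine startsWithTriple_congr fun v hv => ?_
          rw [Finset.mem_erase, and_iff_right]
          rintro rfl
          exact hx _ hℓ hv
        · intro A hA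
          simp only [hA, true_and, not_true, false_and, or_false]
        · intro A hA
          simp only [hA, not_false_iff, true_and, false_and, false_or]
      refine hleaf.query_of_irrelevant (v := x) (.never (U := fun _ => False) fun _ => id)
        ?_ (fun _ => Iff.rfl) ?_ ?_
      · intro A
        have h1 : (∃ ℓ ∈ L, ℓ ∈ insert x A) ↔ ∃ ℓ ∈ L, ℓ ∈ A := by
          refine exists_congr fun ℓ => and_congr_right fun hℓ => ?_
          rw [Finset.mem_insert, or_iff_right]
          rintro rfl
          exact hx1 hℓ
        have h2 : StartsWithTriple s (spineNumber s) (insert x A) ↔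
            StartsWithTriple s (spineNumber s) A := by
          refine startsWithTriple_congr fun v hv => ?_
          rw [Finset.mem_insert, or_iff_right]
          rintro rfl
          exact hx2 hv
        rw [h1, h2, greedy_insert hx2]
      · intro A hxA
        by_cases hLA : ∃ ℓ ∈ L, ℓ ∈ A
        · rw [greedy_cons_of_leaf hxA hLA]
          simp only [hLA, true_and, not_true, false_and, or_false]
          omega
        · simp only [hLA, not_false_iff, true_and, false_and, false_or]
          by_cases ht : ∃ q r t, s = q :: r :: t ∧ q.2 = ∅ ∧ q.1 ∈ A ∧ r.1 ∈ A
          · obtain ⟨q, r, t, rfl, hq, hqA, hrA⟩ := ht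
            rw [greedy_cons_of_triple hxA hLA hq hqA hrA, Nat.add_le_add_iff_left]
            constructor
            · exact fun h => ⟨q, r, t, rfl, hq, hqA, hrA, h⟩
            · rintro ⟨q', r', t', heq, -, -, -, h⟩
              simp only [List.cons.injEq] at heq
              obtain ⟨rfl, rfl, rfl⟩ := heq
              exact h
          · rw [greedy_cons_of_skip hLA fun q r t hst hq hqA hrA =>
              ht ⟨q, r, t, hst, hq, hqA, hrA⟩]
            have := greedy_le_spineNumber hs A
            refine iff_of_false (by omega) ?_
            rintro ⟨q, r, t, hst, hq, hqA, hrA, -⟩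
            exact ht ⟨q, r, t, hst, hq, hqA, hrA⟩
      · intro A hxA
        rw [greedy_cons_of_notMem hxA]
        have := greedy_le_spineNumber hs A
        exact iff_of_false (by omega) id

/-- Deciding greedily whether a set contains a maximum matching of the hypergraph of a spine. -/
theorem decision_spine {l : List (V × Finset V)} (hl : IsProperSpine l) (he : EndsWithLeaf l) :
    Decision (fun A => spineNumber l ≤ greedy 1 1 l A) (spineDegree l) :=
  decision_spine_of_shorter hl he fun ht _ het => decision_spine ht het
termination_by l.length

end SpineDecision

section SpineIdeal

variable {V : Type*} [DecidableEq V]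

theorem spineFacet_weight : ∀ {l : List (V × Finset V)} {F : Finset V}, IsProperSpine l →
    IsSpineFacet l F → ∑ v ∈ F, (if v ∈ spineLeaves l then 2 else 1) = 3
  | [], _, _, h => h.elim
  | p :: s, F, ⟨hp1, hp2, hp3, hs⟩, h => by
    have hpl : p.1 ∉ spineLeaves (p :: s) := by
      rw [spineLeaves, Finset.mem_union, not_or]
      exact ⟨hp1, fun h => hp2 (spineLeaves_subset s h)⟩
    have hsl : ∀ v ∈ spineVertices s, v ∈ spineLeaves (p :: s) ↔ v ∈ spineLeaves s := by
      intro v hv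
      rw [spineLeaves, Finset.mem_union, or_iff_right]
      exact fun h => Finset.disjoint_left.1 hp3 h hv
    rcases h with ⟨ℓ, hℓ, rfl⟩ | ⟨y, q, t, rfl, rfl⟩ | h
    · have hne : p.1 ≠ ℓ := by rintro rfl; exact hp1 hℓ
      have hℓ' : ℓ ∈ spineLeaves (p :: s) := Finset.mem_union_left _ hℓ
      rw [Finset.sum_pair hne, if_neg hpl, if_pos hℓ']
    · obtain ⟨-, hy, -, hq1, hq2, -⟩ := hs
      simp only [spineVertices, Finset.mem_insert, Finset.mem_union, not_or] at hp2 hy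
      have hy' : y ∉ spineLeaves (p :: (y, ∅) :: q :: t) := by
        rw [hsl y (by simp [spineVertices])]
        simp only [spineLeaves, Finset.mem_union, Finset.notMem_empty, not_or]
        exact ⟨id, hy.2.1, fun h => hy.2.2 (spineLeaves_subset t h)⟩
      have hq' : q.1 ∉ spineLeaves (p :: (y, ∅) :: q :: t) := by
        rw [hsl q.1 (by simp [spineVertices])]
        simp only [spineLeaves, Finset.mem_union, Finset.notMem_empty, not_or]
        exact ⟨id, hq1, fun h => hq2 (spineLeaves_subset t h)⟩
      rw [Finset.sum_insert (by simpa using ⟨hp2.1, hp2.2.2.1⟩), Finset.sum_pair hy.1,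
        if_neg hpl, if_neg hy', if_neg hq']
      rfl
    · rw [← spineFacet_weight hs h]
      exact Finset.sum_congr rfl fun v hv => by simp only [hsl v (h.subset hv)]

theorem IsSpineFacet.nonempty : ∀ {l : List (V × Finset V)} {F : Finset V}, IsSpineFacet l F →
    F.Nonempty
  | [], _, h => h.elim
  | _ :: s, F, h => by
    rcases h with ⟨ℓ, -, rfl⟩ | ⟨y, q, t, -, rfl⟩ | h
    · exact Finset.insert_nonempty _ _
    · exact Finset.insert_nonempty _ _
    · exact IsSpineFacet.nonempty h

theorem isMatching_iff_of_facets {Δ : Set (Finset V)} {l : List (V × Finset V)}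
    (hΔ : ∀ F, F ∈ facets Δ ↔ IsSpineFacet l F) {M : Finset (Finset V)} :
    IsMatching Δ M ↔ (∀ F ∈ M, IsSpineFacet l F) ∧ (M : Set (Finset V)).PairwiseDisjoint id :=
  and_congr_left' (forall₂_congr fun F _ => hΔ F)

variable [Fintype V]

theorem matchingNumber_eq_spineNumber {Δ : Set (Finset V)} {l : List (V × Finset V)}
    (hΔ : ∀ F, F ∈ facets Δ ↔ IsSpineFacet l F) (hl : IsProperSpine l) :
    matchingNumber Δ = spineNumber l := by
  refine IsGreatest.csSup_eq ⟨?_, ?_⟩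
  · obtain ⟨M, hM, hd, hc, -⟩ := exists_greedy_matching (A := Finset.univ) hl
    exact ⟨M, (isMatching_iff_of_facets hΔ).2 ⟨fun F hF => (hM F hF).1, hd⟩, hc⟩
  · rintro k ⟨M, hM, rfl⟩
    rw [isMatching_iff_of_facets hΔ] at hM
    exact card_le_greedy (fun F hF => ⟨hM.1 F hF, Finset.subset_univ F⟩) hM.2

theorem exists_matching_iff_le_greedy {Δ : Set (Finset V)} {l : List (V × Finset V)}
    (hΔ : ∀ F, F ∈ facets Δ ↔ IsSpineFacet l F) (hl : IsProperSpine l) (A : Finset V) :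
    (∃ M, IsMatching Δ M ∧ M.card = spineNumber l ∧ ∀ F ∈ M, F ⊆ A) ↔
      spineNumber l ≤ greedy 1 1 l A := by
  constructor
  · rintro ⟨M, hM, hc, hA⟩
    rw [isMatching_iff_of_facets hΔ] at hM
    rw [← hc]
    exact card_le_greedy (fun F hF => ⟨hM.1 F hF, hA F hF⟩) hM.2
  · intro h
    obtain ⟨M, hM, hd, hc, -⟩ := exists_greedy_matching (A := A) hl
    exact ⟨M, (isMatching_iff_of_facets hΔ).2 ⟨fun F hF => (hM F hF).1, hd⟩,
      hc.trans (le_antisymm (greedy_le_spineNumber hl A) h), fun F hF => (hM F hF).2⟩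

/-- All maximum matchings cover sets of the same weight, so none of these sets contains
another one. -/
theorem exists_minimal_matching {Δ : Set (Finset V)} {l : List (V × Finset V)}
    (hΔ : ∀ F, F ∈ facets Δ ↔ IsSpineFacet l F) (hl : IsProperSpine l) :
    ∃ A, Minimal (fun A => ∃ M, IsMatching Δ M ∧ M.card = spineNumber l ∧ ∀ F ∈ M, F ⊆ A) A ∧
      A.card = spineDegree l := by
  have hweight : ∀ {M : Finset (Finset V)}, IsMatching Δ M →
      ∑ v ∈ M.biUnion id, (if v ∈ spineLeaves l then 2 else 1) = 3 * M.card := by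
    intro M hM
    rw [isMatching_iff_of_facets hΔ] at hM
    rw [Finset.sum_biUnion hM.2]
    simp only [id_eq]
    rw [Finset.sum_congr rfl fun F hF =>
      spineFacet_weight hl (hM.1 F hF), Finset.sum_const, smul_eq_mul, mul_comm]
  obtain ⟨M, hM, hd, hc, hs⟩ := exists_greedy_matching (A := Finset.univ) hl
  have hM' : IsMatching Δ M := (isMatching_iff_of_facets hΔ).2 ⟨fun F hF => (hM F hF).1, hd⟩
  refine ⟨M.biUnion id, ⟨⟨M, hM', hc, fun F hF => Finset.subset_biUnion_of_mem id hF⟩, ?_⟩, ?_⟩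
  · rintro B ⟨M₁, hM₁, hc₁, hB⟩ hBM
    have hsub : M₁.biUnion id ⊆ B := Finset.biUnion_subset.2 hB
    refine Finset.Subset.trans ?_ hsub
    intro v hv
    by_contra hv₁
    have hlt := Finset.sum_lt_sum_of_subset (f := fun v => if v ∈ spineLeaves l then 2 else 1)
      (hsub.trans hBM) hv hv₁ (by split_ifs <;> norm_num) fun _ _ _ => Nat.zero_le _
    rw [hweight hM', hweight hM₁, hc₁, show M.card = spineNumber l from hc] at hlt
    exact lt_irrefl _ hlt
  · rw [Finset.card_biUnion fun F hF E hE hne => hd hF hE hne]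
    exact hs

/-- The top squarefree power of the facet ideal of the hypergraph of a spine. -/
theorem exists_hasDegree_and_hasRegularity_of_spine (K : Type*) [Field K] {Δ : Set (Finset V)}
    {l : List (V × Finset V)} (hΔ : ∀ F, F ∈ facets Δ ↔ IsSpineFacet l F) (hl : IsProperSpine l)
    (he : EndsWithLeaf l) (hne : l ≠ []) :
    ∃ D : ℕ, HasDegree (squarefreePower (facetIdeal K Δ) (matchingNumber Δ)) D ∧
      HasRegularity (squarefreePower (facetIdeal K Δ) (matchingNumber Δ)) ((D : ℤ) - 1) := by
  refine ⟨spineDegree l, ?_⟩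
  rw [squarefreePower_facetIdeal (fun F hF => ((hΔ F).1 hF).nonempty),
    matchingNumber_eq_spineNumber hΔ hl]
  refine hasDegree_and_hasRegularity_supportIdeal ?_ ?_
    (one_le_two.trans (two_le_spineDegree hne he)) (exists_minimal_matching hΔ hl)
  · rintro A B hAB ⟨M, hM, hc, hA⟩
    exact ⟨M, hM, hc, fun F hF => (hA F hF).trans hAB⟩
  · exact (decision_spine hl he).congr fun A => exists_matching_iff_le_greedy hΔ hl A

/-- The top squarefree power of the facet ideal of a complex with a single facet that is a
vertex. -/
theorem exists_hasDegree_and_hasRegularity_of_singleton (K : Type*) [Field K]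
    {Δ : Set (Finset V)} {v : V} (hΔ : ∀ F, F ∈ facets Δ ↔ F = {v}) :
    ∃ D : ℕ, HasDegree (squarefreePower (facetIdeal K Δ) (matchingNumber Δ)) D ∧
      HasRegularity (squarefreePower (facetIdeal K Δ) (matchingNumber Δ)) ((D : ℤ) - 1) := by
  have hM : IsMatching Δ {{v}} := ⟨by simp [hΔ], by simp⟩
  have hν : matchingNumber Δ = 1 := by
    refine IsGreatest.csSup_eq ⟨⟨{{v}}, hM, by simp⟩, ?_⟩
    rintro k ⟨M, hM, rfl⟩
    refine Finset.card_le_one.2 fun F hF E hE => ?_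
    rw [(hΔ F).1 (hM.1 F hF), (hΔ E).1 (hM.1 E hE)]
  have hU : ∀ A : Finset V, (∃ M, IsMatching Δ M ∧ M.card = 1 ∧ ∀ F ∈ M, F ⊆ A) ↔ v ∈ A := by
    intro A
    constructor
    · rintro ⟨M, hM, hc, hA⟩
      obtain ⟨F, rfl⟩ := Finset.card_eq_one.1 hc
      have hF := Finset.mem_singleton_self F
      have h1 := hA F hF
      rw [(hΔ F).1 (hM.1 F hF)] at h1
      exact Finset.singleton_subset_iff.1 h1
    · intro h
      exact ⟨{{v}}, hM, by simp, by simpa using h⟩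
  refine ⟨1, ?_⟩
  rw [squarefreePower_facetIdeal (fun F hF => by rw [(hΔ F).1 hF]; exact Finset.singleton_nonempty v),
    hν, funext fun A => propext (hU A)]
  refine hasDegree_and_hasRegularity_supportIdeal (fun A B hAB hA => hAB hA) ?_ le_rfl
    ⟨{v}, ⟨Finset.mem_singleton_self v, fun B hB _ => Finset.singleton_subset_iff.2 hB⟩,
      Finset.card_singleton v⟩
  exact .query v (.always fun A => Finset.mem_insert_self v A)
    (.never fun A => Finset.notMem_erase v A)

end SpineIdeal

/-! ### The closed neighborhoods of a caterpillar -/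

theorem mem_closedNeighborhood {V : Type*} [Fintype V] {G : SimpleGraph V} {u v : V} :
    v ∈ closedNeighborhood G u ↔ v = u ∨ G.Adj u v := by
  simp [closedNeighborhood]

theorem mem_facets_neighborhoodComplex {V : Type*} [Fintype V] {G : SimpleGraph V} {F : Finset V} :
    F ∈ facets (neighborhoodComplex G) ↔ ∃ u, F = closedNeighborhood G u ∧
      ∀ v, ¬ closedNeighborhood G v ⊂ closedNeighborhood G u := by
  constructor
  · rintro ⟨⟨u, hFu, hu⟩, hmax⟩
    exact ⟨u, hFu.antisymm (hmax ⟨u, subset_rfl, hu⟩ hFu), hu⟩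
  · rintro ⟨u, rfl, hu⟩
    refine ⟨⟨u, subset_rfl, hu⟩, ?_⟩
    rintro F' ⟨v, hF'v, hv⟩ huF'
    exact hF'v.trans (not_not.1 fun hn => hv u ⟨huF'.trans hF'v, hn⟩)

theorem support_subset_of_isAcyclic {V : Type*} [DecidableEq V] {G : SimpleGraph V}
    (hG : G.IsAcyclic) {a b u v : V} {P : G.Walk a b} {R : G.Walk u v}
    (hR : R.IsPath) (hu : u ∈ P.support) (hv : v ∈ P.support) :
    R.support ⊆ P.support := by
  let W := (P.takeUntil u hu).reverse.append (P.takeUntil v hv)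
  have h : R = W.bypass :=
    congrArg Subtype.val ((hG.subsingleton_path _ _).elim ⟨R, hR⟩ ⟨W.bypass, W.bypass_isPath⟩)
  rw [h]
  intro w hw
  have hw' := W.support_bypass_subset_support hw
  rw [SimpleGraph.Walk.mem_support_append_iff, SimpleGraph.Walk.support_reverse,
    List.mem_reverse] at hw'
  exact hw'.elim (fun h => P.support_takeUntil_subset_support hu h)
    (fun h => P.support_takeUntil_subset_support hv h)

section Graph

variable {V : Type*} [Fintype V] [DecidableEq V] {G : SimpleGraph V} {Q : List V}

open Classical in
/-- The neighbors of `u` outside the list `Q`. -/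
def pendants (G : SimpleGraph V) (Q : List V) (u : V) : Finset V :=
  Finset.univ.filter fun w => G.Adj u w ∧ w ∉ Q

theorem mem_pendants {u w : V} : w ∈ pendants G Q u ↔ G.Adj u w ∧ w ∉ Q := by
  simp [pendants]

/-- `Q` lists the vertices of an induced path whose end vertices have neighbors outside of it,
and every vertex outside of it has exactly one neighbor, which lies in `Q`. -/
structure IsSpine (G : SimpleGraph V) (Q : List V) : Prop where
  nodup : Q.Nodup
  adj_succ : ∀ {i u v}, Q[i]? = some u → Q[i + 1]? = some v → G.Adj u v
  eq_succ_of_adj : ∀ {i j u v}, Q[i]? = some u → Q[j]? = some v → G.Adj u v → j = i + 1 ∨ i = j + 1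
  exists_adj_of_notMem : ∀ {w}, w ∉ Q → ∃ u ∈ Q, G.Adj w u
  eq_of_adj_of_notMem : ∀ {w u v}, w ∉ Q → G.Adj w u → G.Adj w v → u = v
  ne_nil : Q ≠ []
  pendants_head : ∀ {u}, Q.head? = some u → (pendants G Q u).Nonempty
  pendants_last : ∀ {u}, Q.getLast? = some u → (pendants G Q u).Nonempty

/-- The list of the spine vertices with their pendant neighbors. -/
def spineList (G : SimpleGraph V) (Q T : List V) : List (V × Finset V) :=
  T.map fun u => (u, pendants G Q u)

theorem mem_spineVertices_spineList {T : List V} {v : V} :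
    v ∈ spineVertices (spineList G Q T) ↔ ∃ u ∈ T, v = u ∨ v ∈ pendants G Q u := by
  induction T with
  | nil => simp [spineList, spineVertices]
  | cons u T ih =>
    change v ∈ insert u (pendants G Q u ∪ spineVertices (spineList G Q T)) ↔ _
    rw [Finset.mem_insert, Finset.mem_union, ih, List.exists_mem_cons_iff, or_assoc]

theorem isSpineFacet_spineList_iff {T : List V} {F : Finset V} :
    IsSpineFacet (spineList G Q T) F ↔ (∃ u ∈ T, ∃ ℓ ∈ pendants G Q u, F = {u, ℓ}) ∨
      ∃ i x y z, T[i]? = some x ∧ T[i + 1]? = some y ∧ T[i + 2]? = some z ∧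
        pendants G Q y = ∅ ∧ F = {x, y, z} := by
  induction T with
  | nil => simp [spineList, IsSpineFacet]
  | cons u T ih =>
    change (∃ ℓ ∈ pendants G Q u, F = {u, ℓ}) ∨ (∃ y q t, spineList G Q T = (y, ∅) :: q :: t ∧
      F = {u, y, q.1}) ∨ IsSpineFacet (spineList G Q T) F ↔ _
    rw [ih]
    constructor
    · rintro (⟨ℓ, hℓ, rfl⟩ | ⟨y, q, t, hT, rfl⟩ | ⟨v, hv, ℓ, hℓ, rfl⟩ | ⟨i, x, y, z, hx, hy, hz, h⟩)
      · exact Or.inl ⟨u, List.mem_cons_self, ℓ, hℓ, rfl⟩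
      · match T with
        | [] => simp [spineList] at hT
        | [_] => simp [spineList] at hT
        | y' :: z :: T =>
          simp only [spineList, List.map_cons, List.cons.injEq, Prod.mk.injEq] at hT
          obtain ⟨⟨rfl, h⟩, rfl, -⟩ := hT
          exact Or.inr ⟨0, u, y', z, rfl, rfl, rfl, h, rfl⟩
      · exact Or.inl ⟨v, List.mem_cons_of_mem _ hv, ℓ, hℓ, rfl⟩
      · exact Or.inr ⟨i + 1, x, y, z, hx, hy, hz, h⟩
    · rintro (⟨v, hv, ℓ, hℓ, rfl⟩ | ⟨i, x, y, z, hx, hy, hz, h, rfl⟩)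
      · rcases List.mem_cons.1 hv with rfl | hv
        · exact Or.inl ⟨ℓ, hℓ, rfl⟩
        · exact Or.inr (Or.inr (Or.inl ⟨v, hv, ℓ, hℓ, rfl⟩))
      · match i with
        | 0 =>
          match T with
          | [] => simp at hy
          | [_] => simp at hz
          | y' :: z' :: T =>
            simp only [List.getElem?_cons_zero, List.getElem?_cons_succ, Option.some.injEq, zero_add]
              at hx hy hz
            subst hx hy hz
            exact Or.inr (Or.inl ⟨y', (z', pendants G Q z'), spineList G Q T,
              by simp [spineList, h], rfl⟩)
        | i + 1 => exact Or.inr (Or.inr (Or.inr ⟨i, x, y, z, hx, hy, hz, h, rfl⟩))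

namespace IsSpine

theorem isProperSpine (h : IsSpine G Q) {T : List V} (hT : T.Nodup) (hTQ : ∀ u ∈ T, u ∈ Q) :
    IsProperSpine (spineList G Q T) := by
  induction T with
  | nil => trivial
  | cons u T ih =>
    rw [List.nodup_cons] at hT
    have hu := hTQ u List.mem_cons_self
    have hTQ' := fun v hv => hTQ v (List.mem_cons_of_mem u hv)
    refine ⟨fun hu' => G.irrefl (mem_pendants.1 hu').1, ?_, ?_, ih hT.2 hTQ'⟩
    · change u ∉ spineVertices (spineList G Q T)
      rw [mem_spineVertices_spineList]
      rintro ⟨v, hv, rfl | hu'⟩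
      · exact hT.1 hv
      · exact (mem_pendants.1 hu').2 hu
    · change Disjoint (pendants G Q u) (spineVertices (spineList G Q T))
      rw [Finset.disjoint_left]
      intro w hw
      rw [mem_spineVertices_spineList]
      rw [mem_pendants] at hw
      rintro ⟨v, hv, rfl | hw'⟩
      · exact hw.2 (hTQ' _ hv)
      · rw [mem_pendants] at hw'
        obtain rfl := h.eq_of_adj_of_notMem hw.2 hw.1.symm hw'.1.symm
        exact hT.1 hv

theorem endsWithLeaf {T : List V}
    (hT : ∀ {u}, T.getLast? = some u → (pendants G Q u).Nonempty) :
    EndsWithLeaf (spineList G Q T) := by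
  induction T with
  | nil => trivial
  | cons u T ih =>
    match T with
    | [] => exact hT rfl
    | v :: T => exact ih fun hu => hT (by rw [List.getLast?_cons_cons]; exact hu)

theorem index_unique (h : IsSpine G Q) {i j : ℕ} {u : V} (hi : Q[i]? = some u)
    (hj : Q[j]? = some u) : i = j :=
  (List.getElem?_inj (List.getElem?_eq_some_iff.1 hi).1 h.nodup).1 (hi.trans hj.symm)

theorem closedNeighborhood_of_notMem (h : IsSpine G Q) {u w : V} (hw : w ∉ Q) (hu : G.Adj u w) :
    closedNeighborhood G w = {u, w} := by
  ext v
  rw [mem_closedNeighborhood, Finset.mem_insert, Finset.mem_singleton, or_comm]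
  exact or_congr_left
    ⟨fun hv => h.eq_of_adj_of_notMem hw hv hu.symm, fun hv => hv ▸ hu.symm⟩

theorem closedNeighborhood_of_triple (h : IsSpine G Q) {i : ℕ} {x y z : V} (hx : Q[i]? = some x)
    (hy : Q[i + 1]? = some y) (hz : Q[i + 2]? = some z) (hp : pendants G Q y = ∅) :
    closedNeighborhood G y = {x, y, z} := by
  ext v
  rw [mem_closedNeighborhood]
  simp only [Finset.mem_insert, Finset.mem_singleton]
  constructor
  · rintro (rfl | hv)
    · simp
    · by_cases hvQ : v ∈ Q
      · obtain ⟨j, hj⟩ := List.mem_iff_getElem?.1 hvQ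
        rcases h.eq_succ_of_adj hy hj hv with rfl | hij
        · exact Or.inr (Or.inr (Option.some.inj (hj.symm.trans hz)))
        · obtain rfl : i = j := by omega
          exact Or.inl (Option.some.inj (hj.symm.trans hx))
      · have : v ∈ pendants G Q y := mem_pendants.2 ⟨hv, hvQ⟩
        rw [hp] at this
        simp at this
  · rintro (rfl | rfl | rfl)
    · exact Or.inr (h.adj_succ hx hy).symm
    · exact Or.inl rfl
    · exact Or.inr (h.adj_succ hy hz)

theorem card_triple (h : IsSpine G Q) {i : ℕ} {x y z : V} (hx : Q[i]? = some x)
    (hy : Q[i + 1]? = some y) (hz : Q[i + 2]? = some z) : ({x, y, z} : Finset V).card = 3 := by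
  rw [Finset.card_eq_three]
  refine ⟨x, y, z, ?_, ?_, ?_, rfl⟩
  · rintro rfl
    have := h.index_unique hx hy
    omega
  · rintro rfl
    have := h.index_unique hx hz
    omega
  · rintro rfl
    have := h.index_unique hy hz
    omega

theorem exists_triple (h : IsSpine G Q) {u : V} (hu : u ∈ Q) (hp : pendants G Q u = ∅) :
    ∃ i x z, Q[i]? = some x ∧ Q[i + 1]? = some u ∧ Q[i + 2]? = some z := by
  obtain ⟨j, hj⟩ := List.mem_iff_getElem?.1 hu
  have hjl := (List.getElem?_eq_some_iff.1 hj).1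
  match j with
  | 0 =>
    have := h.pendants_head (u := u) (by rw [List.head?_eq_getElem?, hj])
    simp [hp] at this
  | i + 1 =>
    have hlast : i + 2 < Q.length := by
      by_contra hlt
      have := h.pendants_last (u := u) (by
        rw [List.getLast?_eq_getElem?, show Q.length - 1 = i + 1 by omega, hj])
      simp [hp] at this
    exact ⟨i, Q[i], Q[i + 2], List.getElem?_eq_getElem _, hj, List.getElem?_eq_getElem _⟩

theorem two_le_card_closedNeighborhood (h : IsSpine G Q) (v : V) :
    2 ≤ (closedNeighborhood G v).card := by
  have hv : ∃ w, G.Adj v w := by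
    by_cases hvQ : v ∈ Q
    · rcases (pendants G Q v).eq_empty_or_nonempty with hp | ⟨w, hw⟩
      · obtain ⟨i, x, z, -, hy, hz⟩ := h.exists_triple hvQ hp
        exact ⟨z, h.adj_succ hy hz⟩
      · exact ⟨w, (mem_pendants.1 hw).1⟩
    · obtain ⟨u, -, hu⟩ := h.exists_adj_of_notMem hvQ
      exact ⟨u, hu⟩
  obtain ⟨w, hw⟩ := hv
  rw [← Finset.card_pair hw.ne]
  refine Finset.card_le_card ?_
  simp [Finset.insert_subset_iff, mem_closedNeighborhood, hw]

theorem mem_facets_iff (h : IsSpine G Q) (F : Finset V) :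
    F ∈ facets (neighborhoodComplex G) ↔ IsSpineFacet (spineList G Q Q) F := by
  rw [mem_facets_neighborhoodComplex, isSpineFacet_spineList_iff]
  constructor
  · rintro ⟨u, rfl, hmin⟩
    by_cases hu : u ∈ Q
    · rcases (pendants G Q u).eq_empty_or_nonempty with hp | ⟨w, hw⟩
      · obtain ⟨i, x, z, hx, hy, hz⟩ := h.exists_triple hu hp
        exact Or.inr ⟨i, x, u, z, hx, hy, hz, hp, h.closedNeighborhood_of_triple hx hy hz hp⟩
      · have hw' := mem_pendants.1 hw
        have hNw := h.closedNeighborhood_of_notMem hw'.2 hw'.1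
        have hsub : closedNeighborhood G w ⊆ closedNeighborhood G u := by
          rw [hNw]
          simp [Finset.insert_subset_iff, mem_closedNeighborhood, hw'.1]
        refine Or.inl ⟨u, hu, w, hw, ?_⟩
        rw [← hNw]
        exact (not_not.1 fun hn => hmin w ⟨hsub, hn⟩).antisymm hsub
    · obtain ⟨v, hv, huv⟩ := h.exists_adj_of_notMem hu
      exact Or.inl ⟨v, hv, u, mem_pendants.2 ⟨huv.symm, hu⟩,
        h.closedNeighborhood_of_notMem hu huv.symm⟩
  · rintro (⟨u, hu, w, hw, rfl⟩ | ⟨i, x, y, z, hx, hy, hz, hp, rfl⟩)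
    · rw [mem_pendants] at hw
      have hNw := h.closedNeighborhood_of_notMem hw.2 hw.1
      refine ⟨w, hNw.symm, fun v hv => ?_⟩
      have h1 := Finset.card_lt_card hv
      have h2 := h.two_le_card_closedNeighborhood v
      rw [hNw, Finset.card_pair hw.1.ne] at h1
      omega
    · have hNy := h.closedNeighborhood_of_triple hx hy hz hp
      refine ⟨y, hNy.symm, fun v hv => ?_⟩
      rw [hNy] at hv
      have hQ : ∀ w ∈ closedNeighborhood G v, w ∈ Q := by
        intro w hw
        have hw' := hv.1 hw
        simp only [Finset.mem_insert, Finset.mem_singleton] at hw'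
        rcases hw' with rfl | rfl | rfl
        · exact List.mem_of_getElem? hx
        · exact List.mem_of_getElem? hy
        · exact List.mem_of_getElem? hz
      have hvp : pendants G Q v = ∅ := by
        refine Finset.eq_empty_of_forall_notMem fun w hw => ?_
        rw [mem_pendants] at hw
        exact hw.2 (hQ w (mem_closedNeighborhood.2 (Or.inr hw.1)))
      obtain ⟨j, x', z', hx', hy', hz'⟩ :=
        h.exists_triple (hQ v (mem_closedNeighborhood.2 (Or.inl rfl))) hvp
      have h1 := Finset.card_lt_card hv
      rw [h.closedNeighborhood_of_triple hx' hy' hz' hvp, h.card_triple hx' hy' hz',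
        h.card_triple hx hy hz] at h1
      omega

end IsSpine

/-- A path dominates a graph if every vertex lies on it or is adjacent to it. -/
def IsDominating {a b : V} (P : G.Walk a b) : Prop :=
  ∀ w, w ∈ P.support ∨ ∃ x ∈ P.support, G.Adj x w

/-- The first vertex of a shortest dominating path has a neighbor outside the path. -/
theorem pendants_start_nonempty {a b : V} {P : G.Walk a b} (hV : Nontrivial V) (hP : P.IsPath)
    (hdom : IsDominating P)
    (hmin : ∀ {c d : V} (R : G.Walk c d), R.IsPath → IsDominating R → P.length ≤ R.length) :
    (pendants G P.support a).Nonempty := by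
  by_contra hne
  have hp : ∀ w, G.Adj a w → w ∈ P.support := by
    intro w hw
    by_contra hwP
    exact hne ⟨w, mem_pendants.2 ⟨hw, hwP⟩⟩
  cases P with
  | nil =>
    obtain ⟨w, hw⟩ := exists_ne a
    rcases hdom w with h | ⟨x, hx, hxw⟩
    · simp at h
      exact hw h
    · simp at hx
      subst hx
      have := hp w hxw
      simp at this
      exact hw this
  | @cons _ c _ hac R =>
    have hdomR : IsDominating R := by
      have key : ∀ w ∈ (SimpleGraph.Walk.cons hac R).support,
          w ∈ R.support ∨ ∃ x ∈ R.support, G.Adj x w := by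
        intro w hw
        rw [SimpleGraph.Walk.support_cons, List.mem_cons] at hw
        rcases hw with rfl | hw
        · exact Or.inr ⟨c, R.start_mem_support, hac.symm⟩
        · exact Or.inl hw
      intro w
      rcases hdom w with h | ⟨x, hx, hxw⟩
      · exact key w h
      · rw [SimpleGraph.Walk.support_cons, List.mem_cons] at hx
        rcases hx with rfl | hx
        · exact key w (hp w hxw)
        · exact Or.inr ⟨x, hx, hxw⟩
    have := hmin R hP.of_cons hdomR
    rw [SimpleGraph.Walk.length_cons] at this
    omega

theorem isSpine_of_shortest (hG : G.IsTree) {a b : V} {P : G.Walk a b} (hV : Nontrivial V)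
    (hP : P.IsPath) (hdom : IsDominating P)
    (hmin : ∀ {c d : V} (R : G.Walk c d), R.IsPath → IsDominating R → P.length ≤ R.length) :
    IsSpine G P.support := by
  have hac := hG.isAcyclic
  have hget : ∀ {i : ℕ} {u : V}, P.support[i]? = some u → i ≤ P.length ∧ P.getVert i = u := by
    intro i u h
    have hi : i ≤ P.length := by
      have := (List.getElem?_eq_some_iff.1 h).1
      rw [SimpleGraph.Walk.length_support] at this
      omega
    rw [← P.getVert_eq_support_getElem? hi] at h
    exact ⟨hi, Option.some.inj h⟩
  have hchord : ∀ {i j : ℕ}, j ≤ P.length → i < j → G.Adj (P.getVert i) (P.getVert j) →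
      j = i + 1 := by
    intro i j hj hij hadj
    obtain ⟨k, rfl⟩ : ∃ k, j = i + k := ⟨j - i, by omega⟩
    rw [← P.drop_getVert i k] at hadj
    have h := (hac.subsingleton_path _ _).elim ⟨(P.drop i).take k, (hP.drop i).take k⟩
      (SimpleGraph.Path.singleton hadj)
    have h2 := congrArg (fun p => p.1.length) h
    simp only [SimpleGraph.Walk.take_length, SimpleGraph.Walk.drop_length,
      SimpleGraph.Path.singleton, SimpleGraph.Walk.length_cons, SimpleGraph.Walk.length_nil] at h2
    omega
  have hleaf : ∀ {w u : V}, w ∉ P.support → u ∈ P.support → G.Adj w u →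
      ∀ {v : V}, G.Adj w v → v = u := by
    intro w u hw hu hwu v hwv
    by_contra hvu
    have hwu' : u ≠ w := by rintro rfl; exact hw hu
    by_cases hv : v ∈ P.support
    · have hR : (SimpleGraph.Walk.cons hwu.symm (.cons hwv .nil)).IsPath := by
        simp [SimpleGraph.Walk.cons_isPath_iff, hwu', Ne.symm hvu, hwv.ne]
      exact hw (support_subset_of_isAcyclic hac hR hu hv (by simp))
    · obtain ⟨x, hx, hxv⟩ := (hdom v).resolve_left hv
      have hxw : x ≠ w := by rintro rfl; exact hw hx
      by_cases hux : u = x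
      · subst hux
        have h := (hac.subsingleton_path _ _).elim
          ⟨SimpleGraph.Walk.cons hwu (.cons hxv .nil), by
            simp [SimpleGraph.Walk.cons_isPath_iff, hwu'.symm, hxv.ne, hwv.ne]⟩
          (SimpleGraph.Path.singleton hwv)
        have h2 := congrArg (fun p => p.1.length) h
        simp [SimpleGraph.Path.singleton] at h2
      · have hR : (SimpleGraph.Walk.cons hwu.symm (.cons hwv (.cons hxv.symm .nil))).IsPath := by
          simp [SimpleGraph.Walk.cons_isPath_iff, hwu', Ne.symm hvu, hwv.ne, hxv.ne', hxw.symm, hux]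
        exact hw (support_subset_of_isAcyclic hac hR hu hx (by simp))
  have hdomw : ∀ {w : V}, w ∉ P.support → ∃ u ∈ P.support, G.Adj w u := by
    intro w hw
    obtain ⟨x, hx, hxw⟩ := (hdom w).resolve_left hw
    exact ⟨x, hx, hxw.symm⟩
  have hrev : ∀ w, w ∈ P.reverse.support ↔ w ∈ P.support := fun w => by
    rw [SimpleGraph.Walk.support_reverse, List.mem_reverse]
  refine ⟨hP.support_nodup, ?_, ?_, hdomw, ?_, P.support_ne_nil, ?_, ?_⟩
  · intro i u v hu hv
    obtain ⟨-, rfl⟩ := hget hu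
    obtain ⟨hi, rfl⟩ := hget hv
    exact P.adj_getVert_succ (by omega)
  · intro i j u v hu hv hadj
    obtain ⟨hi, rfl⟩ := hget hu
    obtain ⟨hj, rfl⟩ := hget hv
    rcases lt_trichotomy i j with hij | rfl | hij
    · exact Or.inl (hchord hj hij hadj)
    · exact absurd hadj G.irrefl
    · exact Or.inr (hchord hi hij hadj.symm)
  · intro w u v hw hwu hwv
    obtain ⟨x, hx, hwx⟩ := hdomw hw
    rw [hleaf hw hx hwx hwu, hleaf hw hx hwx hwv]
  · intro u hu
    have h : P.support.head? = some a := by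
      rw [← SimpleGraph.Walk.cons_tail_support, List.head?_cons]
    obtain rfl := Option.some.inj (h.symm.trans hu)
    exact pendants_start_nonempty hV hP hdom hmin
  · intro u hu
    have h : P.support.getLast? = some b := by
      rw [List.getLast?_eq_some_getLast P.support_ne_nil, SimpleGraph.Walk.getLast_support]
    obtain rfl := Option.some.inj (h.symm.trans hu)
    obtain ⟨w, hw⟩ := pendants_start_nonempty (P := P.reverse) hV hP.reverse
      (fun w => by simpa only [hrev] using hdom w)
      (fun R hR hRd => by rw [SimpleGraph.Walk.length_reverse]; exact hmin R hR hRd)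
    rw [mem_pendants, hrev] at hw
    exact ⟨w, mem_pendants.2 hw⟩

theorem IsCaterpillar.exists_isSpine (hG : IsCaterpillar G) (hV : Nontrivial V) :
    ∃ Q, IsSpine G Q := by
  classical
  obtain ⟨htree, a, b, P, hP, hdom⟩ := hG
  have hex : ∃ n, ∃ (a b : V) (P : G.Walk a b), P.IsPath ∧ IsDominating P ∧ P.length = n :=
    ⟨_, a, b, P, hP, hdom, rfl⟩
  obtain ⟨c, d, R, hR, hRd, hRl⟩ := Nat.find_spec hex
  exact ⟨R.support, isSpine_of_shortest htree hV hR hRd fun T hT hTd => by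
    rw [hRl]
    exact Nat.find_min' hex ⟨_, _, T, hT, hTd, rfl⟩⟩

end Graph

end CaterpillarReg

end

theorem theorem5p5 {V : Type*} [Fintype V] (G : SimpleGraph V)
    (hG : CaterpillarReg.IsCaterpillar G) (K : Type*) [Field K] :
    ∃ D : ℕ,
      CaterpillarReg.HasDegree
        (CaterpillarReg.squarefreePower (CaterpillarReg.closedNeighborhoodIdeal K G)
          (CaterpillarReg.matchingNumber (CaterpillarReg.neighborhoodComplex G))) D ∧
      CaterpillarReg.HasRegularity
        (CaterpillarReg.squarefreePower (CaterpillarReg.closedNeighborhoodIdeal K G)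
          (CaterpillarReg.matchingNumber (CaterpillarReg.neighborhoodComplex G))) ((D : ℤ) - 1) := by
  classical
  rcases subsingleton_or_nontrivial V with hV | hV
  · obtain ⟨-, a, -⟩ := hG
    have hN : ∀ u, CaterpillarReg.closedNeighborhood G u = {a} := by
      intro u
      ext v
      simp [CaterpillarReg.mem_closedNeighborhood, Subsingleton.elim v u, Subsingleton.elim u a]
    refine CaterpillarReg.exists_hasDegree_and_hasRegularity_of_singleton K (v := a) fun F => ?_
    rw [CaterpillarReg.mem_facets_neighborhoodComplex]
    simp only [hN]
    exact ⟨fun ⟨_, h, _⟩ => h, fun h => ⟨a, h, fun _ => ssubset_irrefl _⟩⟩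
  · obtain ⟨Q, hQ⟩ := hG.exists_isSpine hV
    refine CaterpillarReg.exists_hasDegree_and_hasRegularity_of_spine K hQ.mem_facets_iff
      (hQ.isProperSpine hQ.nodup fun _ h => h) (CaterpillarReg.IsSpine.endsWithLeaf hQ.pendants_last)
      fun h => hQ.ne_nil ?_
    simpa [CaterpillarReg.spineList] using h
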